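/- **Setting.** Let $f_{i,j}:\mathbb R^d\to\mathbb R$ ($i\in[N]$, $j\in[M]$), $f_i=\frac1M\sum_{j=1}^M f_{i,j}$, $f=\frac1N\sum_{i=1}^N f_i$. For a nonempty $I\subseteq[M]$ write $\nabla_I f_i(x)=\frac1{|I|}\sum_{j\in I}\nabla f_{i,j}(x)$. Let $L>0$ and assume that every $f_{i,j}$ is differentiable with $\|\nabla f_{i,j}(x)-\nabla f_{i,j}(y)\|\le L\|x-y\|$ for all $x,y$, that $f$ is convex, and that $f$ has a minimizer $x^*$. **Algorithm (FedPAGE).** Parameters: $x^0\in\mathbb R^d$, $1\le S\le N$, $K\ge1$, step sizes $\eta_g,\eta_l>0$, minibatch sizes $b_1,b_2,b_3\in\{1,\dots,M\}$, probabilities $p_r$. In round $r=0,1,2,\dots$ draw $q\sim\mathrm{Bernoulli}(p_r)$. - If $q=1$, every client $i\in[N]$ draws a uniform $\mathcal I_1\subseteq[M]$ of size $b_1$, and $g^r=\frac1N\sum_{i=1}^N\nabla_{\mathcal I_1}f_i(x^r)$. - If $q=0$, draw a uniform $S^r\subseteq[N]$ of size $S$. Every $i\in S^r$ draws a uniform $\mathcal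 I_2\subseteq[M]$ of size $b_2$ and sets $y_{i,0}=x^r$, $g_{i,0}=\nabla_{\mathcal I_2}f_i(x^r)-\nabla_{\mathcal I_2}f_i(x^{r-1})+g^{r-1}$, $y_{i,1}=y_{i,0}-\eta_l g_{i,0}$; for $k=1,\dots,K-1$ it draws a uniform $\mathcal I_3\subseteq[M]$ of size $b_3$ and sets $g_{i,k}=\nabla_{\mathcal I_3}f_i(y_{i,k})-\nabla_{\mathcal I_3}f_i(y_{i,k-1})+g_{i,k-1}$, $y_{i,k+1}=y_{i,k}-\eta_l g_{i,k}$. Then $g^r=\frac1{K\eta_lS}\sum_{i\in S^r}(x^r-y_{i,K})$. Finally $x^{r+1}=x^r-\eta_g g^r$. All draws (over rounds, clients and local steps) are independent. **Theorem 4.** There are absolute constants $c_g,c_l>0$ and, for every $a\in(0,c_g]$, a constant $C=C(a)>0$, such that the following holds for all $d,N,M,K,S,R\ge1$ with $S\le N$, all $L,\varepsilon>0$, all $b_3\in\{1,\dots,M\}$, all functions as above and all $x^0$. Let $p_0=1$ and $p_r=p=S/N$ for $r\ge1$. Suppose that either $b_1=b_2=M$, or there is $\sigma\ge0$ with $\frac1M\sum_{j=1}^M\|\nabla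 f_{i,j}(x)-\nabla f_i(x)\|^2\le\sigma^2$ for all $i$ and $x$, and $$b_1\ge\min\Big\{M,\frac{24\sigma^2}{p^{1/2}\sqrt S\,L\varepsilon}\Big\},\qquad b_2\ge\min\Big\{M,\frac{48\sigma^2}{p^{3/2}\sqrt S\,\varepsilon}\Big\}.$$ Suppose further that $$a\,\frac{(S+N^{3/4})\frac SN}{L(S+\sqrt N)}\le\eta_g\le c_g\,\frac{(S+N^{3/4})\frac SN}{L(S+\sqrt N)},\qquad 0<\eta_l\le c_l\,\frac{S}{N^{5/4}KL\sqrt R}.$$ Then FedPAGE satisfies $$\frac1R\sum_{r=0}^{R-1}\mathbb E\big[f(x^{r+1})-f(x^*)\big]\le\begin{cases}C\Big(\dfrac{N^{3/4}L\|x^0-x^*\|^2}{SR}+\varepsilon\Big),&S\le\sqrt N,\\[2mm] C\Big(\dfrac{N^{1/4}L\|x^0-x^*\|^2}{R}+\varepsilon\Big),&\sqrt N<S\le N^{3/4},\\[2mm] C\Big(\dfrac{NL\|x^0-x^*\|^2}{SR}+\varepsilon\Big),&N^{3/4}<S.\end{cases}$$ -/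

import Mathlib

open MeasureTheory ProbabilityTheory

namespace FedPAGE

/-- The parameter space `ℝ^d` with its Euclidean norm. -/
abbrev Vec (d : ℕ) : Type := EuclideanSpace ℝ (Fin d)

/-- `h` is differentiable and its gradient is `L`-Lipschitz. -/
def LSmooth {d : ℕ} (L : ℝ) (h : Vec d → ℝ) : Prop :=
  Differentiable ℝ h ∧ ∀ x₁ x₂ : Vec d, ‖gradient h x₁ - gradient h x₂‖ ≤ L * ‖x₁ - x₂‖

/-- `f_i(x) = (1/M) ∑_j f_{i,j}(x)`: the average of the data losses `φ j = f_{i,j}` of one client. -/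
noncomputable def clientLoss {d M : ℕ} (φ : Fin M → Vec d → ℝ) (x : Vec d) : ℝ :=
  (1 / (M : ℝ)) * ∑ j, φ j x

/-- `f(x) = (1/N) ∑_i f_i(x)`. -/
noncomputable def globalLoss {d N M : ℕ} (f : Fin N → Fin M → Vec d → ℝ) (x : Vec d) : ℝ :=
  (1 / (N : ℝ)) * ∑ i, clientLoss (f i) x

/-- For every client, the variance of the gradients over its data is at most `σ ^ 2`,
at every point. -/
def BoundedVariance {d N M : ℕ} (σ : ℝ) (f : Fin N → Fin M → Vec d → ℝ) : Prop :=
  ∀ (i : Fin N) (x : Vec d),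
    (1 / (M : ℝ)) * ∑ j, ‖gradient (f i j) x - gradient (clientLoss (f i)) x‖ ^ 2 ≤ σ ^ 2

/-- `∇_I f_i(x) = (1/|I|) ∑_{j ∈ I} ∇ f_{i,j}(x)`. -/
noncomputable def batchGrad {d M : ℕ} (φ : Fin M → Vec d → ℝ) (I : Finset (Fin M)) (x : Vec d) :
    Vec d :=
  (1 / (I.card : ℝ)) • ∑ j ∈ I, gradient (φ j) x

/-- The subsets of `Fin n` with exactly `b` elements. -/
abbrev Batch (n b : ℕ) : Type := {I : Finset (Fin n) // I.card = b}

/-- One outcome of all the sets sampled in a round: the set of `S` participating clients and, for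
every client, the minibatches `ℐ₁`, `ℐ₂` and the `K - 1` minibatches `ℐ₃` of the local steps
`1, …, K - 1` (entry `k` of `batch₃ i` belongs to local step `k + 1`). Sets that the branch
taken in the round does not look at are drawn but never used. -/
@[ext]
structure RoundDraw (N S M K b₁ b₂ b₃ : ℕ) : Type where
  clients : Batch N S
  batch₁ : Fin N → Batch M b₁
  batch₂ : Fin N → Batch M b₂
  batch₃ : Fin N → Fin (K - 1) → Batch M b₃

instance {N S M K b₁ b₂ b₃ : ℕ} : Finite (RoundDraw N S M K b₁ b₂ b₃) :=
  Finite.of_injective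
    (fun z : RoundDraw N S M K b₁ b₂ b₃ => (z.clients, z.batch₁, z.batch₂, z.batch₃))
    (by
      intro z w h
      simp only [Prod.mk.injEq] at h
      exact RoundDraw.ext h.1 h.2.1 h.2.2.1 h.2.2.2)

instance {N S M K b₁ b₂ b₃ : ℕ} : MeasurableSpace (RoundDraw N S M K b₁ b₂ b₃) := ⊤

/-- The randomness of the algorithm, on a probability space `(Ω, μ)`. In round `r`, the coin
`q r` is Bernoulli with parameter `p r`, the draw `Z r` is uniform on the finite set of all
outcomes (so the client set and all minibatches are uniform and mutually independent), and the
two are independent; different rounds are independent. -/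
structure IsSampling {Ω : Type*} [MeasurableSpace Ω] (μ : Measure Ω) {N S M K b₁ b₂ b₃ : ℕ}
    (p : ℕ → ℝ) (q : ℕ → Ω → Bool) (Z : ℕ → Ω → RoundDraw N S M K b₁ b₂ b₃) : Prop where
  measurable_coin : ∀ r, Measurable (q r)
  measurable_draw : ∀ r, Measurable (Z r)
  law : ∀ (r : ℕ) (c : Bool) (z : RoundDraw N S M K b₁ b₂ b₃),
    μ.real {ω | q r ω = c ∧ Z r ω = z} =
      (if c = true then p r else 1 - p r) * (1 / (Nat.card (RoundDraw N S M K b₁ b₂ b₃) : ℝ))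
  indep : iIndepFun (fun r ω => (q r ω, Z r ω)) μ

/-- The pair `(y_{i,k}, g_{i,k})` of one client with data losses `φ`, started from `y_{i,0} = y₀`
and `g_{i,0} = g₀`; `I k` is the minibatch of local step `k + 1`. -/
noncomputable def localSteps {d M : ℕ} (φ : Fin M → Vec d → ℝ) (ηl : ℝ) (I : ℕ → Finset (Fin M))
    (y₀ g₀ : Vec d) : ℕ → Vec d × Vec d
  | 0 => (y₀, g₀)
  | k + 1 =>
      let y := (localSteps φ ηl I y₀ g₀ k).1
      let g := (localSteps φ ηl I y₀ g₀ k).2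
      let y' := y - ηl • g
      (y', batchGrad φ (I k) y' - batchGrad φ (I k) y + g)

/-- The server's memory before round `r`: `x^{r-1}`, `x^r` and `g^{r-1}`. -/
structure State (d : ℕ) : Type where
  xPrev : Vec d
  x : Vec d
  gPrev : Vec d

/-- `Δy_i^r = x^r - y_{i,K}^r`, the change made by client `i` in `K` local steps. The last local
iterate is `y_{i,K} = y_{i,K-1} - η_l g_{i,K-1}`. -/
noncomputable def localChange {d N S M K b₁ b₂ b₃ : ℕ} (f : Fin N → Fin M → Vec d → ℝ) (ηl : ℝ)
    (z : RoundDraw N S M K b₁ b₂ b₃) (s : State d) (i : Fin N) : Vec d :=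
  let I₂ : Finset (Fin M) := z.batch₂ i
  let I₃ : ℕ → Finset (Fin M) := fun k => if h : k < K - 1 then z.batch₃ i ⟨k, h⟩ else ∅
  let g₀ := batchGrad (f i) I₂ s.x - batchGrad (f i) I₂ s.xPrev + s.gPrev
  let last := localSteps (f i) ηl I₃ s.x g₀ (K - 1)
  s.x - (last.1 - ηl • last.2)

/-- The server's gradient estimator `g^r`: with coin `true`, all clients send minibatch gradients
at `x^r`; otherwise the `S` sampled clients send their local changes. -/
noncomputable def serverGrad {d N S M K b₁ b₂ b₃ : ℕ} (f : Fin N → Fin M → Vec d → ℝ) (ηl : ℝ)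
    (c : Bool) (z : RoundDraw N S M K b₁ b₂ b₃) (s : State d) : Vec d :=
  if c = true then
    (1 / (N : ℝ)) • ∑ i, batchGrad (f i) (z.batch₁ i) s.x
  else
    (1 / ((K : ℝ) * ηl * (S : ℝ))) • ∑ i ∈ z.clients.1, localChange f ηl z s i

/-- The state before round `r`. Before round `0` there is no `x^{-1}` and no `g^{-1}`; the values
put there are not used when the coin of round `0` is `true`, as it is for `p_0 = 1`. -/
noncomputable def run {d N S M K b₁ b₂ b₃ : ℕ} (f : Fin N → Fin M → Vec d → ℝ) (ηg ηl : ℝ)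
    (x₀ : Vec d) (c : ℕ → Bool) (z : ℕ → RoundDraw N S M K b₁ b₂ b₃) : ℕ → State d
  | 0 => ⟨x₀, x₀, 0⟩
  | r + 1 =>
      let s := run f ηg ηl x₀ c z r
      let g := serverGrad f ηl (c r) (z r) s
      ⟨s.x, s.x - ηg • g, g⟩

/-- The iterate `x^r` of FedPAGE as a random variable. -/
noncomputable def iterate {Ω : Type*} {d N S M K b₁ b₂ b₃ : ℕ} (f : Fin N → Fin M → Vec d → ℝ)
    (ηg ηl : ℝ) (x₀ : Vec d) (q : ℕ → Ω → Bool) (Z : ℕ → Ω → RoundDraw N S M K b₁ b₂ b₃)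
    (r : ℕ) (ω : Ω) : Vec d :=
  (run f ηg ηl x₀ (fun t => q t ω) (fun t => Z t ω) r).x

/-- The order of the global step size: `(S + N^{3/4}) (S/N) / (L (S + √N))`. -/
noncomputable def globalStepScale (N S : ℕ) (L : ℝ) : ℝ :=
  (((S : ℝ) + (N : ℝ) ^ (3 / 4 : ℝ)) * ((S : ℝ) / (N : ℝ))) / (L * ((S : ℝ) + √(N : ℝ)))

/-- The order of the local step size: `S / (N^{5/4} K L √R)`. -/
noncomputable def localStepScale (N S K R : ℕ) (L : ℝ) : ℝ :=
  (S : ℝ) / ((N : ℝ) ^ (5 / 4 : ℝ) * (K : ℝ) * L * √(R : ℝ))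

/-- `(1/R) ∑_{r=0}^{R-1} E[f(x^{r+1}) - f(x^*)]`. -/
noncomputable def averageGap {Ω : Type*} [MeasurableSpace Ω] (μ : Measure Ω)
    {d N S M K b₁ b₂ b₃ : ℕ} (f : Fin N → Fin M → Vec d → ℝ) (ηg ηl : ℝ) (x₀ xstar : Vec d)
    (q : ℕ → Ω → Bool) (Z : ℕ → Ω → RoundDraw N S M K b₁ b₂ b₃) (R : ℕ) : ℝ :=
  (1 / (R : ℝ)) * ∑ r ∈ Finset.range R,
    ∫ ω, (globalLoss f (iterate f ηg ηl x₀ q Z (r + 1) ω) - globalLoss f xstar) ∂μ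

end FedPAGE

/-! Write e_r = g^r - ∇f(x^r), D = ‖x^0 - x^*‖², η = η_g, p = S/N and τ = 4 L η_l K. Convexity gives
‖x^{r+1} - x^*‖² ≤ ‖x^r - x^*‖² - 2η (f(x^r) - f(x^*)) - 2η ⟨e_r, x^r - x^*⟩ + η² ‖g^r‖². The
difficulty is the inner product, because g^r is biased: after a round with q = 0 the conditional
mean of e_r is e_{r-1}, up to a drift of norm at most τ ‖g^{r-1}‖ caused by the local steps.

The bias is forgotten, however. A round with q = 1 has a centred error, and ⟨e_{r-1}, x^r - x^*⟩ =
⟨e_{r-1}, x^{r-1} - x^*⟩ - η ⟨e_{r-1}, g^{r-1}⟩. Hence the expected correlation contracts by 1 - p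
per round, forced only by η ‖e‖ ‖g‖ and τ ‖g‖ ‖x - x^*‖, and summing it costs a factor 1/p
(`abs_roundMean_inner_sub_le`, `mul_sum_le_of_contraction`). The mean squared error contracts as
well, forced by the noise ν of the full rounds and by B ‖g‖², where B is (Lη)²/S plus a drift term
(`roundMean_error_le`). The descent lemma bounds η ∑ E‖g^r‖² by a multiple of L D plus noise
(`sum_G_le`).

`IsSampling.gapRecursion` turns these facts into inequalities between real sequences, and
`GapRecursion.sum_F_le` solves them. After Young's inequality the solution needs (Lη)² B / p ≲ p².
Since S = pN, the main part of B turns this into Lη ≲ p N^{1/4}, which is where the power N^{1/4}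
comes from. The prescribed step respects this and Lη ≤ 1/2, the average gap is at most a multiple of
D/(ηR) + ε, and the three rates are upper bounds for 1/η in the three regimes
(`one_le_mul_globalStepScale`). -/

namespace FedPAGE

/-! ### Uniform averages over finite types and product spaces. -/

/-- The mean of a function on a finite type under the uniform distribution. -/
noncomputable def avg {α E : Type*} [Fintype α] [AddCommGroup E] [Module ℝ E] (F : α → E) : E :=
  (Fintype.card α : ℝ)⁻¹ • ∑ x, F x

section Avg

variable {α β E : Type*} [Fintype α] [Fintype β]

section Module

variable [AddCommGroup E] [Module ℝ E]

theorem avg_const [Nonempty α] (c : E) : avg (fun _ : α => c) = c := by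
  simp [avg, ← Nat.cast_smul_eq_nsmul ℝ, smul_smul]

theorem avg_add (F G : α → E) : avg (fun x => F x + G x) = avg F + avg G := by
  simp [avg, Finset.sum_add_distrib]

theorem avg_sub (F G : α → E) : avg (fun x => F x - G x) = avg F - avg G := by
  simp [avg, Finset.sum_sub_distrib, smul_sub]

theorem avg_smul (c : ℝ) (F : α → E) : avg (fun x => c • F x) = c • avg F := by
  simp only [avg, ← Finset.smul_sum, smul_comm c]

theorem avg_sum {ι : Type*} (s : Finset ι) (F : ι → α → E) :
    avg (fun x => ∑ i ∈ s, F i x) = ∑ i ∈ s, avg (F i) := by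
  simp only [avg, Finset.smul_sum]
  rw [Finset.sum_comm]

theorem avg_equiv (e : α ≃ β) (F : β → E) : avg (fun x => F (e x)) = avg F := by
  simp only [avg, Fintype.card_congr e]
  rw [Equiv.sum_comp e F]

theorem avg_prod (F : α × β → E) : avg F = avg fun a => avg fun b => F (a, b) := by
  simp only [avg, Fintype.card_prod, Nat.cast_mul, mul_inv, Fintype.sum_prod_type,
    ← Finset.smul_sum, smul_smul]

theorem avg_fst [Nonempty β] (F : α → E) : avg (fun x : α × β => F x.1) = avg F := by
  rw [avg_prod]
  simp only [avg_const]

/-- The coordinate `i` of a uniform point of `ι → β` is uniform. -/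
theorem avg_pi_apply {ι : Type*} [Fintype ι] [DecidableEq ι] [Nonempty β] (i : ι) (F : β → E) :
    avg (fun I : ι → β => F (I i)) = avg F := by
  rw [← avg_equiv (Equiv.funSplitAt i β).symm]
  simp only [Equiv.funSplitAt_symm_apply, dite_true]
  exact avg_fst F

end Module

theorem avg_mul_left (c : ℝ) (F : α → ℝ) : avg (fun x => c * F x) = c * avg F :=
  avg_smul c F

theorem avg_mono {F G : α → ℝ} (h : ∀ x, F x ≤ G x) : avg F ≤ avg G := by
  simp only [avg, smul_eq_mul]
  exact mul_le_mul_of_nonneg_left (Finset.sum_le_sum fun x _ => h x) (by positivity)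

theorem avg_nonneg {F : α → ℝ} (h : ∀ x, 0 ≤ F x) : 0 ≤ avg F := by
  simp only [avg, smul_eq_mul]
  exact mul_nonneg (by positivity) (Finset.sum_nonneg fun x _ => h x)

section Inner

variable [NormedAddCommGroup E] [InnerProductSpace ℝ E]

theorem avg_inner_left (F : α → E) (v : E) :
    avg (fun x => inner ℝ (F x) v) = inner ℝ (avg F) v := by
  simp [avg, sum_inner, real_inner_smul_left]

theorem norm_avg_le [Nonempty α] {F : α → E} {C : ℝ} (h : ∀ x, ‖F x‖ ≤ C) : ‖avg F‖ ≤ C := by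
  have h1 : ‖avg F‖ ≤ avg fun x => ‖F x‖ := by
    simp only [avg, norm_smul, smul_eq_mul, norm_inv, RCLike.norm_natCast]
    exact mul_le_mul_of_nonneg_left (norm_sum_le _ _) (by positivity)
  exact h1.trans ((avg_mono h).trans (avg_const C).le)

/-- The second moment is the variance plus the squared norm of the mean. -/
theorem avg_norm_sub_avg_sq_add [Nonempty α] (F : α → E) :
    avg (fun x => ‖F x - avg F‖ ^ 2) + ‖avg F‖ ^ 2 = avg fun x => ‖F x‖ ^ 2 := by
  have h : ∀ x, ‖F x - avg F‖ ^ 2 = ‖F x‖ ^ 2 - 2 * inner ℝ (F x) (avg F) + ‖avg F‖ ^ 2 :=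
    fun x => norm_sub_sq_real _ _
  simp only [h]
  rw [avg_add, avg_sub, avg_mul_left, avg_inner_left, avg_const, real_inner_self_eq_norm_sq]
  ring

/-- Cross terms of independent centred vectors vanish. -/
theorem avg_pi_inner_eq_zero {ι : Type*} [Fintype ι] [DecidableEq ι] {w : ι → β → E}
    (hw : ∀ i, avg (w i) = 0) {i j : ι} (hij : j ≠ i) :
    avg (fun I : ι → β => inner ℝ (w i (I i)) (w j (I j))) = 0 := by
  -- Coordinate `i` is averaged innermost, with the others, in particular `j`, frozen.
  rw [← avg_equiv ((Equiv.prodComm _ _).trans (Equiv.funSplitAt i β).symm), avg_prod]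
  simp only [Equiv.trans_apply, Equiv.prodComm_apply, Prod.swap_prod_mk,
    Equiv.funSplitAt_symm_apply, dite_true, dif_neg hij, avg_inner_left, hw, inner_zero_left]
  simp [avg]

/-- The second moment of a sum of independent centred vectors, shifted by a constant. -/
theorem avg_pi_norm_sum_add_sq {ι : Type*} [Fintype ι] [DecidableEq ι] [Nonempty β]
    {w : ι → β → E} (hw : ∀ i, avg (w i) = 0) (s : Finset ι) (c : E) :
    avg (fun I : ι → β => ‖∑ i ∈ s, w i (I i) + c‖ ^ 2) =
      ∑ i ∈ s, avg (fun b => ‖w i b‖ ^ 2) + ‖c‖ ^ 2 := by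
  have h : ∀ I : ι → β, ‖∑ i ∈ s, w i (I i) + c‖ ^ 2 =
      (∑ i ∈ s, ∑ j ∈ s, inner ℝ (w i (I i)) (w j (I j))) +
        2 * inner ℝ (∑ i ∈ s, w i (I i)) c + ‖c‖ ^ 2 := by
    intro I
    rw [norm_add_sq_real, ← real_inner_self_eq_norm_sq (∑ i ∈ s, w i (I i)), sum_inner]
    simp only [inner_sum]
  simp only [h]
  rw [avg_add, avg_add, avg_mul_left, avg_inner_left, avg_sum, avg_sum, avg_const]
  have h2 : ∀ i, avg (fun I : ι → β => w i (I i)) = 0 := fun i => by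
    rw [avg_pi_apply i (w i), hw]
  simp only [h2, Finset.sum_const_zero, inner_zero_left, mul_zero, add_zero]
  congr 1
  refine Finset.sum_congr rfl fun i hi => ?_
  rw [avg_sum, Finset.sum_eq_single i]
  · simp only [real_inner_self_eq_norm_sq]
    exact avg_pi_apply i (fun b => ‖w i b‖ ^ 2)
  · intro j _ hij
    exact avg_pi_inner_eq_zero hw hij
  · exact fun hn => absurd hi hn

end Inner

end Avg

/-! ### Uniform subsets of fixed size: sampling without replacement. -/

section Batch

variable {n b : ℕ} {E : Type*}

theorem Batch.nonempty (h : b ≤ n) : Nonempty (Batch n b) := by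
  obtain ⟨I, -, hI⟩ := Finset.exists_subset_card_eq (s := (Finset.univ : Finset (Fin n))) (n := b)
    (by simpa using h)
  exact ⟨⟨I, hI⟩⟩

/-- The action of a permutation of the points on the sets of size `b`. -/
def batchEquiv (e : Equiv.Perm (Fin n)) : Batch n b ≃ Batch n b where
  toFun A := ⟨A.1.map e.toEmbedding, by simp [A.2]⟩
  invFun A := ⟨A.1.map e.symm.toEmbedding, by simp [A.2]⟩
  left_inv A := by
    ext x
    simp [Finset.mem_map_equiv]
  right_inv A := by
    ext x
    simp [Finset.mem_map_equiv]

theorem mem_batchEquiv (e : Equiv.Perm (Fin n)) (A : Batch n b) (i : Fin n) :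
    e i ∈ (batchEquiv e A).1 ↔ i ∈ A.1 := by
  simp [batchEquiv]

/-- The probability that two given points belong to a uniform set of size `b`. -/
noncomputable def pairProb (n b : ℕ) (i j : Fin n) : ℝ :=
  avg fun A : Batch n b => if i ∈ A.1 ∧ j ∈ A.1 then (1 : ℝ) else 0

theorem pairProb_perm (e : Equiv.Perm (Fin n)) (i j : Fin n) :
    pairProb n b (e i) (e j) = pairProb n b i j := by
  unfold pairProb
  rw [← avg_equiv (batchEquiv e)]
  simp only [mem_batchEquiv]

theorem pairProb_self_eq (i j : Fin n) : pairProb n b i i = pairProb n b j j := by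
  have := pairProb_perm (b := b) (Equiv.swap i j) i i
  rw [Equiv.swap_apply_left] at this
  exact this.symm

/-- The symmetric group is 2-transitive, and the uniform law on subsets is invariant under it. -/
theorem pairProb_offDiag_eq {i j i' j' : Fin n} (h : i ≠ j) (h' : i' ≠ j') :
    pairProb n b i j = pairProb n b i' j' := by
  have h1 : i' ≠ Equiv.swap i i' j := by
    intro hc
    apply h
    have := congrArg (Equiv.swap i i') hc
    simpa using this
  have := pairProb_perm (b := b) (Equiv.swap (Equiv.swap i i' j) j' * Equiv.swap i i') i j
  rw [Equiv.Perm.mul_apply, Equiv.Perm.mul_apply, Equiv.swap_apply_left, Equiv.swap_apply_left,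
    Equiv.swap_apply_of_ne_of_ne h1 h'] at this
  exact this.symm

theorem pairProb_nonneg (i j : Fin n) : 0 ≤ pairProb n b i j :=
  avg_nonneg fun A => by split_ifs <;> simp

/-- The inclusion probabilities are all equal and sum to the expected cardinality `b`. -/
theorem pairProb_self (hb : b ≤ n) (i : Fin n) : pairProb n b i i = (b : ℝ) / n := by
  have := Batch.nonempty hb
  have h : ∑ j, pairProb n b j j = b := by
    unfold pairProb
    rw [← avg_sum]
    simp only [and_self, Finset.sum_ite_mem, Finset.univ_inter, Finset.sum_const, nsmul_eq_mul,
      mul_one]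
    rw [← avg_const (α := Batch n b) (b : ℝ)]
    congr 1
    ext A
    rw [A.2]
  have hn : (n : ℝ) ≠ 0 := by
    have := i.pos
    positivity
  simp only [fun j => pairProb_self_eq (b := b) j i, Finset.sum_const, Finset.card_univ,
    Fintype.card_fin, nsmul_eq_mul] at h
  rw [eq_div_iff hn, mul_comm]
  exact h

theorem avg_batch_sum [AddCommGroup E] [Module ℝ E] (hb : b ≤ n) (w : Fin n → E) :
    avg (fun A : Batch n b => ∑ i ∈ A.1, w i) = ((b : ℝ) / n) • ∑ i, w i := by
  have h : ∀ A : Batch n b,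
      ∑ i ∈ A.1, w i = ∑ i, (if i ∈ A.1 ∧ i ∈ A.1 then (1 : ℝ) else 0) • w i := by
    intro A
    simp [ite_smul]
  simp only [h]
  rw [avg_sum, Finset.smul_sum]
  refine Finset.sum_congr rfl fun i _ => ?_
  rw [← pairProb_self hb i]
  simp only [avg, pairProb, ← Finset.sum_smul, smul_smul, smul_eq_mul]

/-- Sampling without replacement has at most the variance of sampling with replacement. -/
theorem avg_batch_norm_sum_sq_le [NormedAddCommGroup E] [InnerProductSpace ℝ E] (hb : b ≤ n)
    (w : Fin n → E) (hw : ∑ i, w i = 0) :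
    avg (fun A : Batch n b => ‖∑ i ∈ A.1, w i‖ ^ 2) ≤ ((b : ℝ) / n) * ∑ i, ‖w i‖ ^ 2 := by
  have h : ∀ A : Batch n b, ‖∑ i ∈ A.1, w i‖ ^ 2 =
      ∑ i, ∑ j, inner ℝ (w i) (w j) * (if i ∈ A.1 ∧ j ∈ A.1 then (1 : ℝ) else 0) := by
    intro A
    rw [← real_inner_self_eq_norm_sq, sum_inner]
    simp [inner_sum, ite_and]
  have h2 : avg (fun A : Batch n b => ‖∑ i ∈ A.1, w i‖ ^ 2) =
      ∑ i, ∑ j, inner ℝ (w i) (w j) * pairProb n b i j := by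
    simp only [h, avg_sum, avg_mul_left, pairProb]
  rw [h2]
  by_cases hne : ∃ i j : Fin n, i ≠ j
  · obtain ⟨i₀, j₀, h0⟩ := hne
    -- The common off-diagonal probability need not be computed: its total contribution is κ ‖∑ w‖²
    -- = 0, and the remaining diagonal weight b/n - κ is at most b/n because κ ≥ 0.
    set κ := pairProb n b i₀ j₀ with hκ
    have h3 : ∀ i j, inner ℝ (w i) (w j) * pairProb n b i j =
        κ * inner ℝ (w i) (w j) +
          if i = j then ((b : ℝ) / n - κ) * ‖w i‖ ^ 2 else 0 := by
      intro i j
      split_ifs with hij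
      · subst hij
        rw [pairProb_self hb, real_inner_self_eq_norm_sq]
        ring
      · rw [pairProb_offDiag_eq hij h0]
        ring
    simp only [h3, Finset.sum_add_distrib, Finset.sum_ite_eq, Finset.mem_univ, if_true,
      ← Finset.mul_sum, ← inner_sum, ← sum_inner, hw, inner_zero_left, mul_zero, zero_add]
    have : 0 ≤ κ := pairProb_nonneg _ _
    have h4 : 0 ≤ ∑ i, ‖w i‖ ^ 2 := Finset.sum_nonneg fun i _ => by positivity
    nlinarith
  · push Not at hne
    refine le_of_eq ?_
    rw [Finset.mul_sum]
    refine Finset.sum_congr rfl fun i _ => ?_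
    rw [Finset.sum_eq_single i (fun j _ hj => absurd (hne j i) hj) (by simp), pairProb_self hb,
      real_inner_self_eq_norm_sq, mul_comm]

end Batch

/-! ### Smoothness, convexity and gradients of averaged losses. -/

section Smooth

variable {d : ℕ} {L : ℝ} {h : Vec d → ℝ}

theorem hasDerivAt_comp_segment (hd : Differentiable ℝ h) (x v : Vec d) (t : ℝ) :
    HasDerivAt (fun t : ℝ => h (x + t • v)) (inner ℝ (gradient h (x + t • v)) v) t := by
  have h1 : HasDerivAt (fun t : ℝ => x + t • v) v t := by
    simpa using ((hasDerivAt_id t).smul_const v).const_add x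
  have h2 := (hd (x + t • v)).hasFDerivAt.comp_hasDerivAt t h1
  rw [inner_gradient_left]
  exact h2

/-- The quadratic upper bound of a function with Lipschitz gradient. -/
theorem LSmooth.le_quadratic (hh : LSmooth L h) (x v : Vec d) :
    h (x + v) ≤ h x + inner ℝ (gradient h x) v + L / 2 * ‖v‖ ^ 2 := by
  have hb : ∀ t : ℝ, HasDerivAt
      (fun t : ℝ => h x + t * inner ℝ (gradient h x) v + L / 2 * t ^ 2 * ‖v‖ ^ 2)
      (inner ℝ (gradient h x) v + L * t * ‖v‖ ^ 2) t := by
    intro t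
    have h1 : HasDerivAt (fun t : ℝ => t * inner ℝ (gradient h x) v)
        (inner ℝ (gradient h x) v) t := by
      simpa using (hasDerivAt_id t).mul_const (inner ℝ (gradient h x) v)
    have h2 := (((hasDerivAt_pow 2 t).const_mul (L / 2)).mul_const (‖v‖ ^ 2))
    have h3 := (h1.const_add (h x)).add h2
    refine h3.congr_deriv ?_
    simp only [Nat.cast_ofNat, Nat.add_one_sub_one, pow_one]
    ring
  have key := image_le_of_deriv_right_le_deriv_boundary (a := 0) (b := 1)
    (f := fun t : ℝ => h (x + t • v))
    (f' := fun t => inner ℝ (gradient h (x + t • v)) v)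
    (B := fun t : ℝ => h x + t * inner ℝ (gradient h x) v + L / 2 * t ^ 2 * ‖v‖ ^ 2)
    (B' := fun t => inner ℝ (gradient h x) v + L * t * ‖v‖ ^ 2)
    (fun t _ => (hasDerivAt_comp_segment hh.1 x v t).continuousAt.continuousWithinAt)
    (fun t _ => (hasDerivAt_comp_segment hh.1 x v t).hasDerivWithinAt)
    (by simp) (fun t _ => (hb t).continuousAt.continuousWithinAt)
    (fun t _ => (hb t).hasDerivWithinAt)
    (by
      rintro t ⟨ht, -⟩
      have h1 := hh.2 (x + t • v) x
      rw [add_sub_cancel_left, norm_smul, Real.norm_of_nonneg ht] at h1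
      have h2 := real_inner_le_norm (gradient h (x + t • v) - gradient h x) v
      rw [inner_sub_left] at h2
      have h3 := mul_le_mul_of_nonneg_right h1 (norm_nonneg v)
      nlinarith)
  have := key (Set.right_mem_Icc.2 zero_le_one)
  simpa using this

theorem ConvexOn.gradient_inequality (hd : Differentiable ℝ h) (hc : ConvexOn ℝ Set.univ h)
    (x y : Vec d) : h x + inner ℝ (gradient h x) (y - x) ≤ h y := by
  have h1 : ConvexOn ℝ Set.univ (fun t : ℝ => h (x + t • (y - x))) := by
    have := hc.comp_affineMap (AffineMap.lineMap x y)
    rw [Set.preimage_univ] at this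
    refine this.congr fun t _ => ?_
    simp [AffineMap.lineMap_apply, add_comm]
  have h2 := hasDerivAt_comp_segment hd x (y - x) 0
  have h3 := h1.le_slope_of_hasDerivAt (Set.mem_univ 0) (Set.mem_univ 1) zero_lt_one h2
  rw [inner_gradient_left, map_sub]
  simp [slope_def_field] at h3
  linarith

theorem gradient_eq_zero_of_forall_le (xstar : Vec d) (hmin : ∀ x, h xstar ≤ h x) :
    gradient h xstar = 0 := by
  have : IsLocalMin h xstar := Filter.Eventually.of_forall hmin
  rw [gradient, this.fderiv_eq_zero, map_zero]

theorem LSmooth.sub_min_le (hh : LSmooth L h) (xstar : Vec d) (hmin : ∀ x, h xstar ≤ h x)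
    (x : Vec d) : h x - h xstar ≤ L / 2 * ‖x - xstar‖ ^ 2 := by
  have := hh.le_quadratic xstar (x - xstar)
  rw [gradient_eq_zero_of_forall_le xstar hmin, inner_zero_left, add_sub_cancel] at this
  linarith

theorem hasGradientAt_average {ι : Type*} [Fintype ι] {φ : ι → Vec d → ℝ}
    (hφ : ∀ j, Differentiable ℝ (φ j)) (c : ℝ) (x : Vec d) :
    HasGradientAt (fun x => c * ∑ j, φ j x) (c • ∑ j, gradient (φ j) x) x := by
  rw [hasGradientAt_iff_hasFDerivAt]
  have h1 : HasFDerivAt (fun x => ∑ j, φ j x) (∑ j, fderiv ℝ (φ j) x) x :=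
    HasFDerivAt.fun_sum fun j _ => (hφ j x).hasFDerivAt
  refine (h1.const_mul c).congr_fderiv ?_
  simp [gradient]

variable {N M : ℕ} {f : Fin N → Fin M → Vec d → ℝ}

theorem clientLoss_differentiable {φ : Fin M → Vec d → ℝ} (hφ : ∀ j, Differentiable ℝ (φ j)) :
    Differentiable ℝ (clientLoss φ) :=
  fun x => (hasGradientAt_average hφ (1 / (M : ℝ)) x).differentiableAt

theorem gradient_clientLoss {φ : Fin M → Vec d → ℝ} (hφ : ∀ j, Differentiable ℝ (φ j))
    (x : Vec d) : gradient (clientLoss φ) x = (1 / (M : ℝ)) • ∑ j, gradient (φ j) x :=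
  (hasGradientAt_average hφ (1 / (M : ℝ)) x).gradient

theorem gradient_globalLoss (hf : ∀ i j, Differentiable ℝ (f i j)) (x : Vec d) :
    gradient (globalLoss f) x = (1 / (N : ℝ)) • ∑ i, gradient (clientLoss (f i)) x :=
  (hasGradientAt_average (fun i => clientLoss_differentiable (hf i)) (1 / (N : ℝ)) x).gradient

/-- The set may be empty; its mean is then 0, which is why `0 ≤ C` is required. -/
theorem norm_mean_sub_mean_le {ι : Type*} (s : Finset ι) (u v : ι → Vec d) {C : ℝ} (hC : 0 ≤ C)
    (h : ∀ i, ‖u i - v i‖ ≤ C) :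
    ‖(1 / (s.card : ℝ)) • ∑ i ∈ s, u i - (1 / (s.card : ℝ)) • ∑ i ∈ s, v i‖ ≤ C := by
  rw [← smul_sub, ← Finset.sum_sub_distrib, norm_smul, Real.norm_of_nonneg (by positivity)]
  have h1 : ‖∑ i ∈ s, (u i - v i)‖ ≤ s.card * C := by
    have := norm_sum_le_of_le s (f := fun i => u i - v i) (n := fun _ => C) fun i _ => h i
    simpa using this
  rcases s.card.eq_zero_or_pos with h0 | h0
  · simpa [h0] using hC
  · have h0' : (0 : ℝ) < s.card := by exact_mod_cast h0
    calc (1 / (s.card : ℝ)) * ‖∑ i ∈ s, (u i - v i)‖ ≤ (1 / (s.card : ℝ)) * (s.card * C) := by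
          gcongr
      _ = C := by field_simp

theorem norm_batchGrad_sub_le {φ : Fin M → Vec d → ℝ} (hL : 0 ≤ L) (hφ : ∀ j, LSmooth L (φ j))
    (I : Finset (Fin M)) (x y : Vec d) :
    ‖batchGrad φ I x - batchGrad φ I y‖ ≤ L * ‖x - y‖ :=
  norm_mean_sub_mean_le I _ _ (by positivity) fun j => (hφ j).2 x y

theorem clientLoss_lsmooth {φ : Fin M → Vec d → ℝ} (hL : 0 ≤ L) (hφ : ∀ j, LSmooth L (φ j)) :
    LSmooth L (clientLoss φ) := by
  have hd := fun j => (hφ j).1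
  refine ⟨clientLoss_differentiable hd, fun x y => ?_⟩
  rw [gradient_clientLoss hd, gradient_clientLoss hd]
  simpa using norm_mean_sub_mean_le Finset.univ _ _ (by positivity) fun j => (hφ j).2 x y

theorem globalLoss_lsmooth (hL : 0 ≤ L) (hf : ∀ i j, LSmooth L (f i j)) :
    LSmooth L (globalLoss f) := by
  have hd := fun i j => (hf i j).1
  refine ⟨fun x => (hasGradientAt_average (fun i => clientLoss_differentiable (hd i))
    (1 / (N : ℝ)) x).differentiableAt, fun x y => ?_⟩
  rw [gradient_globalLoss hd, gradient_globalLoss hd]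
  simpa using norm_mean_sub_mean_le Finset.univ _ _ (by positivity)
    fun i => (clientLoss_lsmooth hL (hf i)).2 x y

end Smooth

/-! ### Variance of sampling clients and then minibatches. -/

section TwoStage

variable {N S : ℕ} {β E : Type*} [Fintype β] [Nonempty β] [NormedAddCommGroup E]
  [InnerProductSpace ℝ E]

/-- The mean of a two-stage sample: first a set of clients, then one outcome for each client. -/
theorem avg_twoStage_sum (hS : S ≤ N) (W : Fin N → β → E) :
    avg (fun z : Batch N S × (Fin N → β) => ∑ i ∈ z.1.1, W i (z.2 i)) =
      ((S : ℝ) / N) • ∑ i, avg (W i) := by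
  rw [avg_prod]
  simp only [avg_sum]
  simp only [fun i => avg_pi_apply i (W i)]
  exact avg_batch_sum hS _

/-- The variance of a two-stage sample. -/
theorem avg_twoStage_norm_sq_le (hN : 1 ≤ N) (hS : S ≤ N) (V : Fin N → β → E) {C : ℝ}
    (hV : ∀ i b, ‖V i b‖ ≤ C) :
    avg (fun z : Batch N S × (Fin N → β) =>
        ‖∑ i ∈ z.1.1, (V i (z.2 i) - avg fun i => avg (V i))‖ ^ 2) ≤ S * C ^ 2 := by
  have : Nonempty (Fin N) := ⟨⟨0, hN⟩⟩
  have hN' : (0 : ℝ) < N := by exact_mod_cast hN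
  set m : Fin N → E := fun i => avg (V i) with hm
  -- Fluctuation within the clients plus deviation between the client means; the first part is
  -- centred given the client set.
  have hsplit : ∀ z : Batch N S × (Fin N → β), ∑ i ∈ z.1.1, (V i (z.2 i) - avg m) =
      ∑ i ∈ z.1.1, (V i (z.2 i) - m i) + ∑ i ∈ z.1.1, (m i - avg m) := by
    intro z
    rw [← Finset.sum_add_distrib]
    exact Finset.sum_congr rfl fun i _ => by abel
  have hcent : ∀ i, avg (fun b => V i b - m i) = 0 := fun i => by
    rw [avg_sub, avg_const, hm, sub_self]
  have hmean : ∑ i, (m i - avg m) = 0 := by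
    rw [Finset.sum_sub_distrib]
    simp [avg, ← Nat.cast_smul_eq_nsmul ℝ, smul_smul, mul_inv_cancel₀ hN'.ne']
  -- The term -‖m i‖² must be kept: it pays exactly for the variance between clients, so the total
  -- is S C² with constant 1.
  have hvar : ∀ i, avg (fun b => ‖V i b - m i‖ ^ 2) ≤ C ^ 2 - ‖m i‖ ^ 2 := by
    intro i
    have h1 := avg_norm_sub_avg_sq_add (V i)
    have h2 : avg (fun b => ‖V i b‖ ^ 2) ≤ C ^ 2 := by
      rw [← avg_const (α := β) (C ^ 2)]
      exact avg_mono fun b => pow_le_pow_left₀ (norm_nonneg _) (hV i b) 2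
    linarith
  have hbetween : ∑ i, ‖m i - avg m‖ ^ 2 ≤ ∑ i, ‖m i‖ ^ 2 := by
    have h1 := avg_norm_sub_avg_sq_add m
    have h2 : avg (fun i => ‖m i - avg m‖ ^ 2) ≤ avg fun i => ‖m i‖ ^ 2 := by
      nlinarith [sq_nonneg ‖avg m‖]
    simp only [avg, smul_eq_mul, Fintype.card_fin] at h2 ⊢
    exact le_of_mul_le_mul_left h2 (by positivity)
  simp only [hsplit]
  rw [avg_prod]
  simp only [avg_pi_norm_sum_add_sq hcent]
  rw [avg_add, avg_batch_sum hS]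
  have h1 := avg_batch_norm_sum_sq_le hS (fun i => m i - avg m) hmean
  have h2 : ∑ i, avg (fun b => ‖V i b - m i‖ ^ 2) ≤ N * C ^ 2 - ∑ i, ‖m i‖ ^ 2 := by
    refine (Finset.sum_le_sum fun i _ => hvar i).trans_eq ?_
    simp [Finset.sum_sub_distrib]
  rw [smul_eq_mul]
  have h3 : (0 : ℝ) ≤ (S : ℝ) / N := by positivity
  calc _ ≤ ((S : ℝ) / N) * (N * C ^ 2 - ∑ i, ‖m i‖ ^ 2) + ((S : ℝ) / N) * ∑ i, ‖m i‖ ^ 2 :=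
        add_le_add (mul_le_mul_of_nonneg_left h2 h3)
          (h1.trans (mul_le_mul_of_nonneg_left hbetween h3))
    _ = S * C ^ 2 := by
        field_simp
        ring

end TwoStage

/-! ### Mean and variance of minibatch gradients. -/

section Minibatch

variable {d M b : ℕ} {φ : Fin M → Vec d → ℝ}

theorem batchGrad_sub_gradient (hb : 1 ≤ b) (I : Batch M b) (x : Vec d) :
    batchGrad φ I.1 x - gradient (clientLoss φ) x =
      (1 / (b : ℝ)) • ∑ j ∈ I.1, (gradient (φ j) x - gradient (clientLoss φ) x) := by
  have hb' : (b : ℝ) ≠ 0 := by positivity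
  rw [batchGrad, I.2, Finset.sum_sub_distrib, smul_sub, Finset.sum_const, I.2,
    ← Nat.cast_smul_eq_nsmul ℝ, smul_smul, one_div_mul_cancel hb', one_smul]

theorem sum_gradient_sub_eq_zero (hM : 1 ≤ M) (hφ : ∀ j, Differentiable ℝ (φ j)) (x : Vec d) :
    ∑ j, (gradient (φ j) x - gradient (clientLoss φ) x) = 0 := by
  have hM' : (M : ℝ) ≠ 0 := by positivity
  rw [Finset.sum_sub_distrib, gradient_clientLoss hφ, Finset.sum_const, Finset.card_univ,
    Fintype.card_fin, ← Nat.cast_smul_eq_nsmul ℝ, smul_smul, mul_one_div_cancel hM', one_smul,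
    sub_self]

theorem avg_batchGrad (hb : 1 ≤ b) (hbM : b ≤ M) (hφ : ∀ j, Differentiable ℝ (φ j)) (x : Vec d) :
    avg (fun I : Batch M b => batchGrad φ I.1 x) = gradient (clientLoss φ) x := by
  have := Batch.nonempty hbM
  rw [← sub_eq_zero, ← avg_const (α := Batch M b) (gradient (clientLoss φ) x), ← avg_sub]
  simp only [batchGrad_sub_gradient hb]
  rw [avg_smul, avg_batch_sum hbM, sum_gradient_sub_eq_zero (hb.trans hbM) hφ, smul_zero,
    smul_zero]

theorem avg_norm_batchGrad_sub_sq_le (hb : 1 ≤ b) (hbM : b ≤ M)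
    (hφ : ∀ j, Differentiable ℝ (φ j)) (x : Vec d) :
    avg (fun I : Batch M b => ‖batchGrad φ I.1 x - gradient (clientLoss φ) x‖ ^ 2) ≤
      (1 / (M : ℝ) * ∑ j, ‖gradient (φ j) x - gradient (clientLoss φ) x‖ ^ 2) / b := by
  have hb' : (0 : ℝ) < b := by positivity
  have hM' : (0 : ℝ) < M := by exact_mod_cast hb.trans hbM
  simp only [batchGrad_sub_gradient hb, norm_smul, mul_pow]
  rw [avg_mul_left]
  have h1 := avg_batch_norm_sum_sq_le hbM
    (fun j => gradient (φ j) x - gradient (clientLoss φ) x)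
    (sum_gradient_sub_eq_zero (hb.trans hbM) hφ x)
  refine (mul_le_mul_of_nonneg_left h1 (by positivity)).trans_eq ?_
  rw [Real.norm_of_nonneg (by positivity)]
  field_simp

theorem batchGrad_full (hφ : ∀ j, Differentiable ℝ (φ j)) (I : Batch M M) (x : Vec d) :
    batchGrad φ I.1 x = gradient (clientLoss φ) x := by
  have : I.1 = Finset.univ := by
    rw [← Finset.card_eq_iff_eq_univ, I.2, Fintype.card_fin]
  rw [gradient_clientLoss hφ, batchGrad, I.2, this]

end Minibatch

/-! ### Drift of the local gradient estimators. -/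

section LocalSteps

variable {d M : ℕ} {L ηl : ℝ} {φ : Fin M → Vec d → ℝ}

/-- While the drift is at most ‖g₀‖, every estimator has norm at most 2‖g₀‖, so one more step of
length ηl ‖g‖ changes it by at most 2 L ηl ‖g₀‖, whatever minibatch is used. -/
theorem norm_localSteps_grad_sub_le (hL : 0 ≤ L) (hη : 0 ≤ ηl) (hφ : ∀ j, LSmooth L (φ j))
    (I : ℕ → Finset (Fin M)) (y₀ g₀ : Vec d) :
    ∀ k : ℕ, 2 * (L * ηl) * k ≤ 1 →
      ‖(localSteps φ ηl I y₀ g₀ k).2 - g₀‖ ≤ 2 * (L * ηl) * k * ‖g₀‖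
  | 0, _ => by simp [localSteps]
  | k + 1, hk => by
      push_cast at hk ⊢
      have hu : 0 ≤ L * ηl := mul_nonneg hL hη
      have hk' : 2 * (L * ηl) * k ≤ 1 := by linarith
      have ih := norm_localSteps_grad_sub_le hL hη hφ I y₀ g₀ k hk'
      set y := (localSteps φ ηl I y₀ g₀ k).1
      set g := (localSteps φ ηl I y₀ g₀ k).2
      have h1 : ‖batchGrad φ (I k) (y - ηl • g) - batchGrad φ (I k) y‖ ≤ L * ηl * ‖g‖ := by
        have := norm_batchGrad_sub_le hL hφ (I k) (y - ηl • g) y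
        rwa [sub_sub_cancel_left, norm_neg, norm_smul, Real.norm_of_nonneg hη, ← mul_assoc] at this
      have h2 : ‖g‖ ≤ 2 * ‖g₀‖ := by
        have := norm_le_norm_add_norm_sub g₀ g
        rw [norm_sub_rev] at this
        have h3 := mul_le_mul_of_nonneg_right hk' (norm_nonneg g₀)
        linarith
      change ‖batchGrad φ (I k) (y - ηl • g) - batchGrad φ (I k) y + g - g₀‖ ≤ _
      rw [add_sub_assoc]
      have h3 := norm_add_le (batchGrad φ (I k) (y - ηl • g) - batchGrad φ (I k) y) (g - g₀)
      have h4 := mul_le_mul_of_nonneg_left h2 hu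
      linarith

theorem localSteps_displacement (I : ℕ → Finset (Fin M)) (y₀ g₀ : Vec d) : ∀ k : ℕ,
    y₀ - ((localSteps φ ηl I y₀ g₀ k).1 - ηl • (localSteps φ ηl I y₀ g₀ k).2) =
      ηl • ∑ t ∈ Finset.range (k + 1), (localSteps φ ηl I y₀ g₀ t).2
  | 0 => by simp [localSteps]
  | k + 1 => by
      have ih := localSteps_displacement I y₀ g₀ k
      rw [Finset.sum_range_succ, smul_add, ← ih]
      change y₀ - ((localSteps φ ηl I y₀ g₀ k).1 - ηl • (localSteps φ ηl I y₀ g₀ k).2 - _) = _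
      abel

end LocalSteps

/-! ### Bias and variance of the server estimator in the two branches. -/

section ServerGrad

variable {d N S M K b₁ b₂ b₃ : ℕ} {L ηl : ℝ} {f : Fin N → Fin M → Vec d → ℝ}

/-- The first local gradient estimator `g_{i,0}`. -/
noncomputable def localInit (f : Fin N → Fin M → Vec d → ℝ) (I : Finset (Fin M)) (s : State d)
    (i : Fin N) : Vec d :=
  batchGrad (f i) I s.x - batchGrad (f i) I s.xPrev + s.gPrev

theorem norm_localInit_le (hL : 0 ≤ L) (hf : ∀ i j, LSmooth L (f i j)) (I : Finset (Fin M))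
    (s : State d) (i : Fin N) :
    ‖localInit f I s i‖ ≤ L * ‖s.x - s.xPrev‖ + ‖s.gPrev‖ :=
  (norm_add_le _ _).trans (by gcongr; exact norm_batchGrad_sub_le hL (hf i) I _ _)

/-- The normalised local change is the mean of the K local estimators, each close to the first one;
K local steps thus act as a small perturbation of a single step. -/
theorem norm_localChange_sub_le (hK : 1 ≤ K) (hL : 0 ≤ L) (hη : 0 < ηl)
    (hf : ∀ i j, LSmooth L (f i j)) (hu : 2 * (L * ηl) * K ≤ 1)
    (z : RoundDraw N S M K b₁ b₂ b₃) (s : State d) (i : Fin N) :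
    ‖(1 / ((K : ℝ) * ηl)) • localChange f ηl z s i - localInit f (z.batch₂ i) s i‖ ≤
      2 * (L * ηl) * K * ‖localInit f (z.batch₂ i) s i‖ := by
  have hK' : (0 : ℝ) < K := by positivity
  unfold localChange
  simp only [localSteps_displacement]
  change ‖_ - localInit f (z.batch₂ i) s i‖ ≤ _
  rw [Nat.sub_add_cancel hK]
  -- The default `∅` is never read: the estimators of index t < K only use minibatches of index
  -- below K - 1.
  set I₃ : ℕ → Finset (Fin M) := fun k => if h : k < K - 1 then z.batch₃ i ⟨k, h⟩ else ∅
  change ‖(1 / ((K : ℝ) * ηl)) • ηl • ∑ t ∈ Finset.range K,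
    (localSteps (f i) ηl I₃ s.x (localInit f (z.batch₂ i) s i) t).2 - _‖ ≤ _
  set g₀ := localInit f (z.batch₂ i) s i
  have h1 : (1 / ((K : ℝ) * ηl)) • ηl • ∑ t ∈ Finset.range K,
      (localSteps (f i) ηl I₃ s.x g₀ t).2 - g₀ =
      (1 / (K : ℝ)) • ∑ t ∈ Finset.range K, ((localSteps (f i) ηl I₃ s.x g₀ t).2 - g₀) := by
    rw [Finset.sum_sub_distrib, smul_sub, smul_smul, Finset.sum_const, Finset.card_range,
      ← Nat.cast_smul_eq_nsmul ℝ, smul_smul, one_div_mul_cancel hK'.ne', one_smul]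
    congr 2
    field_simp
  rw [h1, norm_smul, Real.norm_of_nonneg (by positivity)]
  have h2 : ‖∑ t ∈ Finset.range K, ((localSteps (f i) ηl I₃ s.x g₀ t).2 - g₀)‖ ≤
      K * (2 * (L * ηl) * K * ‖g₀‖) := by
    have := norm_sum_le_of_le (Finset.range K)
      (f := fun t => (localSteps (f i) ηl I₃ s.x g₀ t).2 - g₀)
      (n := fun _ => 2 * (L * ηl) * K * ‖g₀‖) (by
        intro t ht
        have ht' : (t : ℝ) ≤ K := by exact_mod_cast (Finset.mem_range.1 ht).le
        have h3 : 2 * (L * ηl) * t ≤ 2 * (L * ηl) * K := by gcongr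
        exact (norm_localSteps_grad_sub_le hL hη.le (hf i) I₃ s.x g₀ t (h3.trans hu)).trans
          (by gcongr))
    simpa using this
  calc _ ≤ 1 / (K : ℝ) * (K * (2 * (L * ηl) * K * ‖g₀‖)) := by gcongr
    _ = _ := by field_simp

/-- The server estimator of a communication-saving round with `K = 1` local steps. -/
noncomputable def serverInit (f : Fin N → Fin M → Vec d → ℝ) (s : State d)
    (z : Batch N S × (Fin N → Batch M b₂)) : Vec d :=
  (1 / (S : ℝ)) • ∑ i ∈ z.1.1, localInit f (z.2 i).1 s i

theorem norm_serverGrad_false_sub_le (hK : 1 ≤ K) (hL : 0 ≤ L) (hη : 0 < ηl)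
    (hf : ∀ i j, LSmooth L (f i j)) (hu : 2 * (L * ηl) * K ≤ 1)
    (z : RoundDraw N S M K b₁ b₂ b₃) {s : State d} (hs : L * ‖s.x - s.xPrev‖ ≤ ‖s.gPrev‖) :
    ‖serverGrad f ηl false z s - serverInit f s (z.clients, z.batch₂)‖ ≤
      4 * (L * ηl) * K * ‖s.gPrev‖ := by
  have h1 : serverGrad f ηl false z s = (1 / (z.clients.1.card : ℝ)) •
      ∑ i ∈ z.clients.1, (1 / ((K : ℝ) * ηl)) • localChange f ηl z s i := by
    rw [serverGrad, ← Finset.smul_sum, smul_smul, z.clients.2]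
    simp only [Bool.false_eq_true, if_false]
    congr 1
    rw [one_div_mul_one_div, mul_comm]
  have h2 : serverInit f s (z.clients, z.batch₂) = (1 / (z.clients.1.card : ℝ)) •
      ∑ i ∈ z.clients.1, localInit f (z.batch₂ i).1 s i := by
    rw [serverInit, z.clients.2]
  rw [h1, h2]
  refine norm_mean_sub_mean_le _ _ _ (by positivity) fun i => ?_
  refine (norm_localChange_sub_le hK hL hη hf hu z s i).trans ?_
  have h3 := norm_localInit_le hL hf (z.batch₂ i).1 s i
  have h4 : ‖localInit f (z.batch₂ i).1 s i‖ ≤ 2 * ‖s.gPrev‖ := by linarith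
  calc _ ≤ 2 * (L * ηl) * K * (2 * ‖s.gPrev‖) := by gcongr
    _ = _ := by ring

/-- The new error is the old error plus the sampling error of the gradient difference. The latter is
centred and is controlled by ‖x - xPrev‖ alone, independently of the data variance. -/
theorem serverInit_sub_gradient (hS : 1 ≤ S) (s : State d)
    (z : Batch N S × (Fin N → Batch M b₂)) :
    serverInit f s z - gradient (globalLoss f) s.x =
      (s.gPrev - gradient (globalLoss f) s.xPrev) +
        (1 / (S : ℝ)) • ∑ i ∈ z.1.1, ((batchGrad (f i) (z.2 i).1 s.x -
          batchGrad (f i) (z.2 i).1 s.xPrev) -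
            (gradient (globalLoss f) s.x - gradient (globalLoss f) s.xPrev)) := by
  have hS' : (S : ℝ) ≠ 0 := by positivity
  simp only [serverInit, localInit]
  rw [Finset.sum_add_distrib, Finset.sum_sub_distrib (f := fun i => batchGrad (f i) (z.2 i).1 s.x -
          batchGrad (f i) (z.2 i).1 s.xPrev), Finset.sum_const, Finset.sum_const, z.1.2,
    smul_add, smul_sub, ← Nat.cast_smul_eq_nsmul ℝ, ← Nat.cast_smul_eq_nsmul ℝ, smul_smul,
    smul_smul, one_div_mul_cancel hS', one_smul, one_smul]
  abel

theorem avg_avg_batchGrad_sub (hb : 1 ≤ b₂) (hbM : b₂ ≤ M) (hf : ∀ i j, Differentiable ℝ (f i j))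
    (x y : Vec d) :
    (avg fun i => avg fun I : Batch M b₂ => batchGrad (f i) I.1 x - batchGrad (f i) I.1 y) =
      gradient (globalLoss f) x - gradient (globalLoss f) y := by
  simp only [avg_sub, avg_batchGrad hb hbM (hf _)]
  rw [gradient_globalLoss hf, gradient_globalLoss hf]
  simp [avg]

/-- This is the bias of the estimator: on average the old error is carried over unchanged. -/
theorem avg_serverInit_sub_gradient (hS : 1 ≤ S) (hSN : S ≤ N) (hb : 1 ≤ b₂) (hbM : b₂ ≤ M)
    (hf : ∀ i j, Differentiable ℝ (f i j)) (s : State d) :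
    avg (fun z : Batch N S × (Fin N → Batch M b₂) =>
        serverInit f s z - gradient (globalLoss f) s.x) =
      s.gPrev - gradient (globalLoss f) s.xPrev := by
  have := Batch.nonempty hbM
  have := Batch.nonempty hSN
  have : Nonempty (Fin N) := ⟨⟨0, hS.trans hSN⟩⟩
  simp only [serverInit_sub_gradient hS]
  rw [avg_add, avg_const, avg_smul, avg_twoStage_sum hSN (fun i (I : Batch M b₂) =>
    (batchGrad (f i) I.1 s.x - batchGrad (f i) I.1 s.xPrev) -
            (gradient (globalLoss f) s.x - gradient (globalLoss f) s.xPrev))]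
  have h1 : ∑ i, avg (fun I : Batch M b₂ =>
      (batchGrad (f i) I.1 s.x - batchGrad (f i) I.1 s.xPrev) -
        (gradient (globalLoss f) s.x - gradient (globalLoss f) s.xPrev)) = 0 := by
    have hN : (Fintype.card (Fin N) : ℝ)⁻¹ ≠ 0 := by simp; omega
    refine (smul_eq_zero.1 ?_).resolve_left hN
    change avg (fun i => avg (fun I : Batch M b₂ =>
      (batchGrad (f i) I.1 s.x - batchGrad (f i) I.1 s.xPrev) -
        (gradient (globalLoss f) s.x - gradient (globalLoss f) s.xPrev))) = 0
    simp only [avg_sub _ (fun _ => gradient (globalLoss f) s.x - gradient (globalLoss f) s.xPrev),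
      avg_const, avg_avg_batchGrad_sub hb hbM hf, sub_self]
  rw [h1, smul_zero, smul_zero, add_zero]

/-- The mean of the new error is the old one, so the second moment splits into its square and the
two-stage variance. -/
theorem avg_norm_serverInit_sub_gradient_sq_le (hS : 1 ≤ S) (hSN : S ≤ N) (hb : 1 ≤ b₂)
    (hbM : b₂ ≤ M) (hL : 0 ≤ L) (hf : ∀ i j, LSmooth L (f i j)) (s : State d) :
    avg (fun z : Batch N S × (Fin N → Batch M b₂) =>
        ‖serverInit f s z - gradient (globalLoss f) s.x‖ ^ 2) ≤
      ‖s.gPrev - gradient (globalLoss f) s.xPrev‖ ^ 2 + (L * ‖s.x - s.xPrev‖) ^ 2 / S := by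
  have := Batch.nonempty hbM
  have := Batch.nonempty hSN
  have hd := fun i j => (hf i j).1
  have hS' : (0 : ℝ) < S := by positivity
  have hmean := avg_serverInit_sub_gradient hS hSN hb hbM hd s
  have h1 := avg_norm_sub_avg_sq_add (fun z : Batch N S × (Fin N → Batch M b₂) =>
        serverInit f s z - gradient (globalLoss f) s.x)
  rw [hmean] at h1
  rw [← h1, add_comm]
  gcongr
  simp only [serverInit_sub_gradient hS, add_sub_cancel_left, norm_smul, mul_pow]
  rw [avg_mul_left, ← avg_avg_batchGrad_sub hb hbM hd]
  have h2 := avg_twoStage_norm_sq_le (hS.trans hSN) hSN (fun i (I : Batch M b₂) =>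
    batchGrad (f i) I.1 s.x - batchGrad (f i) I.1 s.xPrev)
    (fun i I => norm_batchGrad_sub_le hL (hf i) I.1 s.x s.xPrev)
  refine (mul_le_mul_of_nonneg_left h2 (by positivity)).trans_eq ?_
  rw [Real.norm_of_nonneg (by positivity)]
  field_simp

/-- The server estimator of a round in which all clients send minibatch gradients. -/
noncomputable def serverFull (f : Fin N → Fin M → Vec d → ℝ) (x : Vec d)
    (I : Fin N → Batch M b₁) : Vec d :=
  (1 / (N : ℝ)) • ∑ i, batchGrad (f i) (I i).1 x

theorem serverFull_sub_gradient (hf : ∀ i j, Differentiable ℝ (f i j)) (x : Vec d)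
    (I : Fin N → Batch M b₁) :
    serverFull f x I - gradient (globalLoss f) x =
      (1 / (N : ℝ)) • ∑ i, (batchGrad (f i) (I i).1 x - gradient (clientLoss (f i)) x) := by
  rw [gradient_globalLoss hf, serverFull, Finset.sum_sub_distrib, smul_sub]

theorem avg_batchGrad_sub_gradient (hb : 1 ≤ b₁) (hbM : b₁ ≤ M)
    (hf : ∀ i j, Differentiable ℝ (f i j)) (x : Vec d) (i : Fin N) :
    avg (fun I : Batch M b₁ => batchGrad (f i) I.1 x - gradient (clientLoss (f i)) x) = 0 := by
  have := Batch.nonempty hbM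
  rw [avg_sub, avg_batchGrad hb hbM (hf i), avg_const, sub_self]

theorem avg_serverFull_sub_gradient (hb : 1 ≤ b₁) (hbM : b₁ ≤ M)
    (hf : ∀ i j, Differentiable ℝ (f i j)) (x : Vec d) :
    avg (fun I : Fin N → Batch M b₁ => serverFull f x I - gradient (globalLoss f) x) = 0 := by
  have := Batch.nonempty hbM
  simp only [serverFull_sub_gradient hf]
  rw [avg_smul, avg_sum]
  simp only [fun i => avg_pi_apply i
    (fun I : Batch M b₁ => batchGrad (f i) I.1 x - gradient (clientLoss (f i)) x),
    avg_batchGrad_sub_gradient hb hbM hf, Finset.sum_const_zero, smul_zero]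

theorem avg_norm_serverFull_sub_gradient_sq_le (hN : 1 ≤ N) (hb : 1 ≤ b₁) (hbM : b₁ ≤ M)
    (hf : ∀ i j, Differentiable ℝ (f i j)) (x : Vec d) {v : ℝ}
    (hv : ∀ i, avg (fun I : Batch M b₁ =>
      ‖batchGrad (f i) I.1 x - gradient (clientLoss (f i)) x‖ ^ 2) ≤ v) :
    avg (fun I : Fin N → Batch M b₁ => ‖serverFull f x I - gradient (globalLoss f) x‖ ^ 2) ≤
      v / N := by
  have := Batch.nonempty hbM
  have hN' : (0 : ℝ) < N := by positivity
  simp only [serverFull_sub_gradient hf, norm_smul, mul_pow]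
  have h1 := avg_pi_norm_sum_add_sq (avg_batchGrad_sub_gradient hb hbM hf x) Finset.univ 0
  simp only [add_zero, norm_zero, ne_eq, OfNat.ofNat_ne_zero, not_false_eq_true, zero_pow] at h1
  rw [avg_mul_left, h1]
  have h2 := Finset.sum_le_sum fun i (_ : i ∈ Finset.univ) => hv i
  refine (mul_le_mul_of_nonneg_left h2 (by positivity)).trans_eq ?_
  rw [Real.norm_of_nonneg (by positivity), Finset.sum_const, Finset.card_univ, Fintype.card_fin,
    nsmul_eq_mul]
  field_simp

end ServerGrad

/-! ### Marginals of the uniform draw of a round. -/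

section Draw

variable {N S M K b₁ b₂ b₃ : ℕ} {E : Type*} [AddCommGroup E] [Module ℝ E]

noncomputable instance : Fintype (RoundDraw N S M K b₁ b₂ b₃) := Fintype.ofFinite _

instance : DiscreteMeasurableSpace (RoundDraw N S M K b₁ b₂ b₃) := ⟨fun _ => trivial⟩

/-- A draw of a round as a tuple of its components. -/
def drawEquiv : RoundDraw N S M K b₁ b₂ b₃ ≃
    (Batch N S × (Fin N → Batch M b₂)) ×
      ((Fin N → Batch M b₁) × (Fin N → Fin (K - 1) → Batch M b₃)) where
  toFun z := ((z.clients, z.batch₂), (z.batch₁, z.batch₃))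
  invFun w := ⟨w.1.1, w.2.1, w.1.2, w.2.2⟩
  left_inv _ := rfl
  right_inv _ := rfl

theorem RoundDraw.nonempty (hS : S ≤ N) (h₁ : b₁ ≤ M) (h₂ : b₂ ≤ M) (h₃ : b₃ ≤ M) :
    Nonempty (RoundDraw N S M K b₁ b₂ b₃) := by
  have := Batch.nonempty hS
  have := Batch.nonempty h₁
  have := Batch.nonempty h₂
  have := Batch.nonempty h₃
  exact ⟨drawEquiv.symm (Classical.arbitrary _)⟩

theorem avg_draw_clients (h₁ : b₁ ≤ M) (h₃ : b₃ ≤ M)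
    (F : Batch N S × (Fin N → Batch M b₂) → E) :
    avg (fun z : RoundDraw N S M K b₁ b₂ b₃ => F (z.clients, z.batch₂)) = avg F := by
  have := Batch.nonempty h₁
  have := Batch.nonempty h₃
  rw [← avg_equiv drawEquiv.symm]
  exact avg_fst F

theorem avg_draw_batch₁ (hS : S ≤ N) (h₂ : b₂ ≤ M) (h₃ : b₃ ≤ M)
    (F : (Fin N → Batch M b₁) → E) :
    avg (fun z : RoundDraw N S M K b₁ b₂ b₃ => F z.batch₁) = avg F := by
  have := Batch.nonempty hS
  have := Batch.nonempty h₂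
  have := Batch.nonempty h₃
  rw [← avg_equiv drawEquiv.symm, avg_prod]
  change avg (fun _ => avg fun w : (Fin N → Batch M b₁) × (Fin N → Fin (K - 1) → Batch M b₃) =>
    F w.1) = avg F
  rw [avg_const, avg_fst]

end Draw

/-! ### Conditional estimates for one round, branch by branch. -/

section Step

variable {d N S M K b₁ b₂ b₃ : ℕ} {L ηl : ℝ} {f : Fin N → Fin M → Vec d → ℝ}

/-- The mean of a quantity over the coin and the draw of one round. -/
noncomputable def roundMean (p : ℝ) (H : Bool → RoundDraw N S M K b₁ b₂ b₃ → ℝ) : ℝ :=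
  p * avg (H true) + (1 - p) * avg (H false)

theorem avg_norm_serverGrad_true_sq_le (hN : 1 ≤ N) (hS : S ≤ N) (h₁ : 1 ≤ b₁) (h₁M : b₁ ≤ M)
    (h₂ : b₂ ≤ M) (h₃ : b₃ ≤ M) (hf : ∀ i j, Differentiable ℝ (f i j)) {v : ℝ} (s : State d)
    (hv : ∀ i, avg (fun I : Batch M b₁ =>
      ‖batchGrad (f i) I.1 s.x - gradient (clientLoss (f i)) s.x‖ ^ 2) ≤ v) :
    avg (fun z : RoundDraw N S M K b₁ b₂ b₃ =>
      ‖serverGrad f ηl true z s - gradient (globalLoss f) s.x‖ ^ 2) ≤ v / N := by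
  have := avg_norm_serverFull_sub_gradient_sq_le hN h₁ h₁M hf s.x hv
  rw [← avg_draw_batch₁ (K := K) hS h₂ h₃] at this
  exact this

theorem avg_inner_serverGrad_true (hS : S ≤ N) (h₁ : 1 ≤ b₁) (h₁M : b₁ ≤ M)
    (h₂ : b₂ ≤ M) (h₃ : b₃ ≤ M) (hf : ∀ i j, Differentiable ℝ (f i j)) (s : State d) (v : Vec d) :
    avg (fun z : RoundDraw N S M K b₁ b₂ b₃ =>
      inner ℝ (serverGrad f ηl true z s - gradient (globalLoss f) s.x) v) = 0 := by
  rw [avg_inner_left]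
  have := avg_serverFull_sub_gradient (N := N) h₁ h₁M hf s.x
  rw [← avg_draw_batch₁ (K := K) hS h₂ h₃] at this
  have h : avg (fun z : RoundDraw N S M K b₁ b₂ b₃ =>
      serverGrad f ηl true z s - gradient (globalLoss f) s.x) = 0 := this
  rw [h, inner_zero_left]

theorem norm_add_sq_le_mul {E : Type*} [NormedAddCommGroup E] (u v : E) {t : ℝ} (ht : 0 < t) :
    ‖u + v‖ ^ 2 ≤ (1 + t) * ‖u‖ ^ 2 + (1 + 1 / t) * ‖v‖ ^ 2 := by
  have h1 := pow_le_pow_left₀ (norm_nonneg _) (norm_add_le u v) 2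
  have h2 : t * ‖u‖ ^ 2 + 1 / t * ‖v‖ ^ 2 - 2 * ‖u‖ * ‖v‖ = (t * ‖u‖ - ‖v‖) ^ 2 / t := by
    field_simp
    ring
  have h3 : 0 ≤ (t * ‖u‖ - ‖v‖) ^ 2 / t := by positivity
  nlinarith

theorem avg_norm_serverGrad_false_sq_le (hK : 1 ≤ K) (hS : 1 ≤ S) (hSN : S ≤ N) (h₁ : b₁ ≤ M)
    (h₂ : 1 ≤ b₂) (h₂M : b₂ ≤ M) (h₃ : b₃ ≤ M) (hL : 0 ≤ L) (hη : 0 < ηl)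
    (hf : ∀ i j, LSmooth L (f i j)) (hu : 2 * (L * ηl) * K ≤ 1) {s : State d}
    (hs : L * ‖s.x - s.xPrev‖ ≤ ‖s.gPrev‖) {t : ℝ} (ht : 0 < t) :
    avg (fun z : RoundDraw N S M K b₁ b₂ b₃ =>
      ‖serverGrad f ηl false z s - gradient (globalLoss f) s.x‖ ^ 2) ≤
      (1 + t) * (‖s.gPrev - gradient (globalLoss f) s.xPrev‖ ^ 2 +
        (L * ‖s.x - s.xPrev‖) ^ 2 / S) +
      (1 + 1 / t) * (4 * (L * ηl) * K * ‖s.gPrev‖) ^ 2 := by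
  have := RoundDraw.nonempty (K := K) hSN h₁ h₂M h₃
  have h1 : ∀ z : RoundDraw N S M K b₁ b₂ b₃,
      ‖serverGrad f ηl false z s - gradient (globalLoss f) s.x‖ ^ 2 ≤
        (1 + t) * ‖serverInit f s (z.clients, z.batch₂) - gradient (globalLoss f) s.x‖ ^ 2 +
        (1 + 1 / t) * (4 * (L * ηl) * K * ‖s.gPrev‖) ^ 2 := by
    intro z
    have h2 := norm_add_sq_le_mul
      (serverInit f s (z.clients, z.batch₂) - gradient (globalLoss f) s.x)
      (serverGrad f ηl false z s - serverInit f s (z.clients, z.batch₂)) ht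
    rw [sub_add_sub_cancel'] at h2
    refine h2.trans ?_
    gcongr
    exact norm_serverGrad_false_sub_le hK hL hη hf hu z hs
  refine (avg_mono h1).trans ?_
  rw [avg_add, avg_const, avg_mul_left, avg_draw_clients h₁ h₃
    (fun w => ‖serverInit f s w - gradient (globalLoss f) s.x‖ ^ 2)]
  gcongr
  exact avg_norm_serverInit_sub_gradient_sq_le hS hSN h₂ h₂M hL hf s

/-- Averaging before taking norms leaves only the drift of the local steps; the sampling noise does
not enter the correlation. -/
theorem abs_avg_inner_serverGrad_false_sub_le (hK : 1 ≤ K) (hS : 1 ≤ S) (hSN : S ≤ N)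
    (h₁ : b₁ ≤ M) (h₂ : 1 ≤ b₂) (h₂M : b₂ ≤ M) (h₃ : b₃ ≤ M) (hL : 0 ≤ L) (hη : 0 < ηl)
    (hf : ∀ i j, LSmooth L (f i j)) (hu : 2 * (L * ηl) * K ≤ 1) {s : State d}
    (hs : L * ‖s.x - s.xPrev‖ ≤ ‖s.gPrev‖) (v : Vec d) :
    |avg (fun z : RoundDraw N S M K b₁ b₂ b₃ =>
        inner ℝ (serverGrad f ηl false z s - gradient (globalLoss f) s.x) v) -
      inner ℝ (s.gPrev - gradient (globalLoss f) s.xPrev) v| ≤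
      4 * (L * ηl) * K * ‖s.gPrev‖ * ‖v‖ := by
  have := RoundDraw.nonempty (K := K) hSN h₁ h₂M h₃
  have h1 : avg (fun z : RoundDraw N S M K b₁ b₂ b₃ =>
      serverInit f s (z.clients, z.batch₂) - gradient (globalLoss f) s.x) =
      s.gPrev - gradient (globalLoss f) s.xPrev := by
    rw [avg_draw_clients h₁ h₃ (fun w => serverInit f s w - gradient (globalLoss f) s.x)]
    exact avg_serverInit_sub_gradient hS hSN h₂ h₂M (fun i j => (hf i j).1) s
  rw [avg_inner_left, ← h1, ← inner_sub_left, ← avg_sub]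
  refine (abs_real_inner_le_norm _ _).trans ?_
  gcongr
  refine norm_avg_le fun z => ?_
  rw [sub_sub_sub_cancel_right]
  exact norm_serverGrad_false_sub_le hK hL hη hf hu z hs

end Step

/-! ### Dependence of the state on past draws. -/

section State

variable {d N S M K b₁ b₂ b₃ : ℕ} {ηg ηl : ℝ} {f : Fin N → Fin M → Vec d → ℝ} {x₀ : Vec d}

theorem run_congr {c c' : ℕ → Bool} {z z' : ℕ → RoundDraw N S M K b₁ b₂ b₃} :
    ∀ r : ℕ, (∀ t < r, c t = c' t) → (∀ t < r, z t = z' t) →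
      run f ηg ηl x₀ c z r = run f ηg ηl x₀ c' z' r
  | 0, _, _ => rfl
  | r + 1, hc, hz => by
      have ih := run_congr (c := c) (c' := c') (z := z) (z' := z') r
        (fun t ht => hc t (ht.trans r.lt_succ_self)) (fun t ht => hz t (ht.trans r.lt_succ_self))
      simp only [run, ih, hc r r.lt_succ_self, hz r r.lt_succ_self]

variable {Ω : Type*} {q : ℕ → Ω → Bool} {Z : ℕ → Ω → RoundDraw N S M K b₁ b₂ b₃}

/-- The state before round `r` as a random variable. -/
noncomputable def stateAt (f : Fin N → Fin M → Vec d → ℝ) (ηg ηl : ℝ) (x₀ : Vec d)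
    (q : ℕ → Ω → Bool) (Z : ℕ → Ω → RoundDraw N S M K b₁ b₂ b₃) (r : ℕ) (ω : Ω) : State d :=
  run f ηg ηl x₀ (fun t => q t ω) (fun t => Z t ω) r

/-- The state before round `r` is a function of the draws of the earlier rounds. -/
theorem exists_stateAt_eq [Nonempty (RoundDraw N S M K b₁ b₂ b₃)] (r : ℕ) :
    ∃ st : (Finset.range r → Bool × RoundDraw N S M K b₁ b₂ b₃) → State d,
      ∀ ω, stateAt f ηg ηl x₀ q Z r ω = st fun t => (q t ω, Z t ω) := by
  classical
  -- Rounds from `r` on are padded with arbitrary values, which the state before round `r` does not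
  -- see.
  refine ⟨fun w => run f ηg ηl x₀
    (fun t => if h : t ∈ Finset.range r then (w ⟨t, h⟩).1 else true)
    (fun t => if h : t ∈ Finset.range r then (w ⟨t, h⟩).2 else Classical.arbitrary _) r,
    fun ω => ?_⟩
  refine run_congr r (fun t ht => ?_) (fun t ht => ?_) <;>
  simp [ht]

end State

/-! ### Integrability and conditioning on the past. -/

section Probability

variable {Ω : Type*} [MeasurableSpace Ω] {μ : Measure Ω}
  {d N S M K b₁ b₂ b₃ : ℕ} {ηg ηl : ℝ} {f : Fin N → Fin M → Vec d → ℝ} {x₀ : Vec d}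
  {P : ℕ → ℝ} {q : ℕ → Ω → Bool} {Z : ℕ → Ω → RoundDraw N S M K b₁ b₂ b₃}

theorem IsSampling.measurable_pair (hs : IsSampling μ P q Z) (r : ℕ) :
    Measurable fun ω => (q r ω, Z r ω) :=
  (hs.measurable_coin r).prodMk (hs.measurable_draw r)

variable [IsProbabilityMeasure μ]

theorem integrable_comp_of_finite {α : Type*} [Finite α] [MeasurableSpace α]
    [MeasurableSingletonClass α] {X : Ω → α} (hX : Measurable X) (F : α → ℝ) :
    Integrable (fun ω => F (X ω)) μ := by
  have : IsFiniteMeasure (μ.map X) := inferInstance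
  exact (Integrable.of_finite (f := F) (μ := μ.map X)).comp_measurable hX

/-- For independent `X`, `Y` with finitely many values, the mean over `Y` can be taken first. -/
theorem integral_indep_finite {α β : Type*} [Finite α] [MeasurableSpace α]
    [MeasurableSingletonClass α] [Fintype β] [MeasurableSpace β] [MeasurableSingletonClass β]
    {X : Ω → α} {Y : Ω → β} (hX : Measurable X) (hY : Measurable Y) (hXY : IndepFun X Y μ)
    (H : α → β → ℝ) :
    ∫ ω, H (X ω) (Y ω) ∂μ = ∫ ω, ∑ y, μ.real {ω | Y ω = y} * H (X ω) y ∂μ := by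
  classical
  -- Decomposing over the values of `Y` gives a finite sum of products, and independence factors
  -- each of them.
  have h1 : ∀ ω, H (X ω) (Y ω) = ∑ y, H (X ω) y * ({y} : Set β).indicator 1 (Y ω) := by
    intro ω
    rw [Finset.sum_eq_single (Y ω)]
    · simp
    · intro y _ hy
      simp [Ne.symm hy]
    · simp
  have hint : ∀ (F : α × β → ℝ), Integrable (fun ω => F (X ω, Y ω)) μ :=
    fun F => integrable_comp_of_finite (hX.prodMk hY) F
  simp only [h1]
  rw [integral_finsetSum _ fun y _ =>
    hint fun w => H w.1 y * ({y} : Set β).indicator 1 w.2,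
    integral_finsetSum _ fun y _ => (integrable_comp_of_finite hX fun x => H x y).const_mul _]
  refine Finset.sum_congr rfl fun y _ => ?_
  rw [hXY.integral_fun_comp_mul_comp (f := fun x => H x y) hX.aemeasurable hY.aemeasurable
    (StronglyMeasurable.of_discrete.aestronglyMeasurable)
    (StronglyMeasurable.of_discrete.aestronglyMeasurable), integral_const_mul, mul_comm]
  congr 1
  have h2 : (fun ω => ({y} : Set β).indicator (1 : β → ℝ) (Y ω)) =
      ({ω | Y ω = y} : Set Ω).indicator 1 := by
    ext ω
    simp [Set.indicator_apply]
  rw [h2, integral_indicator_one]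
  exact hY (measurableSet_singleton y)

/-- The state takes finitely many values through the past draws, so no measurability of `F` is
needed. -/
theorem IsSampling.integrable_stateAt [Nonempty (RoundDraw N S M K b₁ b₂ b₃)]
    (hs : IsSampling μ P q Z) (r : ℕ) (F : State d → ℝ) :
    Integrable (fun ω => F (stateAt f ηg ηl x₀ q Z r ω)) μ := by
  obtain ⟨st, hst⟩ := exists_stateAt_eq (f := f) (ηg := ηg) (ηl := ηl) (x₀ := x₀) (q := q) (Z := Z) r
  simp only [hst]
  exact integrable_comp_of_finite
    (measurable_pi_lambda _ fun t : Finset.range r => hs.measurable_pair t) fun w => F (st w)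

/-- This replaces conditional expectation: the state depends on earlier rounds only, so the coin and
draw of round `r` can be averaged out with the state held fixed. -/
theorem IsSampling.integral_round [Nonempty (RoundDraw N S M K b₁ b₂ b₃)]
    (hs : IsSampling μ P q Z) (r : ℕ)
    (H : State d → Bool → RoundDraw N S M K b₁ b₂ b₃ → ℝ) :
    ∫ ω, H (stateAt f ηg ηl x₀ q Z r ω) (q r ω) (Z r ω) ∂μ =
      ∫ ω, roundMean (P r) (H (stateAt f ηg ηl x₀ q Z r ω)) ∂μ := by
  obtain ⟨st, hst⟩ := exists_stateAt_eq (f := f) (ηg := ηg) (ηl := ηl) (x₀ := x₀) (q := q) (Z := Z) r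
  simp only [hst]
  have hind : IndepFun (fun ω (t : Finset.range r) => (q t ω, Z t ω))
      (fun ω => (q r ω, Z r ω)) μ := by
    have h1 := hs.indep.indepFun_finset (Finset.range r) {r} (by simp) hs.measurable_pair
    have hψ : Measurable fun w : ({r} : Finset ℕ) → Bool × RoundDraw N S M K b₁ b₂ b₃ =>
        w ⟨r, Finset.mem_singleton_self r⟩ := measurable_pi_apply _
    exact h1.comp measurable_id hψ
  rw [integral_indep_finite
    (measurable_pi_lambda _ fun t : Finset.range r => hs.measurable_pair t)
    (hs.measurable_pair r) hind (fun w y => H (st w) y.1 y.2)]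
  congr 1
  ext ω
  have hlaw : ∀ y : Bool × RoundDraw N S M K b₁ b₂ b₃, μ.real {ω | (q r ω, Z r ω) = y} =
      (if y.1 = true then P r else 1 - P r) *
        (Fintype.card (RoundDraw N S M K b₁ b₂ b₃) : ℝ)⁻¹ := by
    intro y
    rw [← Nat.card_eq_fintype_card, ← one_div, ← hs.law r y.1 y.2]
    congr 1
    ext ω
    simp [Prod.ext_iff]
  simp only [hlaw, Fintype.sum_prod_type, Fintype.sum_bool, if_true, Bool.false_eq_true, if_false,
    roundMean, avg, smul_eq_mul, mul_assoc, ← Finset.mul_sum]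

end Probability

/-! ### Solving the recursion between real sequences. -/

section Sequences

/-- Summing a contractive recursion. -/
theorem mul_sum_le_of_contraction {u v : ℕ → ℝ} {ρ : ℝ} (hρ1 : ρ ≤ 1)
    (hv : ∀ r, 0 ≤ v r) (h0 : u 0 ≤ 0) (hu : ∀ r, u (r + 1) ≤ (1 - ρ) * u r + v r) (hρ : 0 ≤ ρ)
    (n : ℕ) : ρ * ∑ r ∈ Finset.range (n + 1), u r ≤ ∑ r ∈ Finset.range n, v r := by
  -- The sequence `u` may be negative; its positive part obeys the same recursion, and then the last
  -- term can be absorbed using ρ ≤ 1.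
  set m : ℕ → ℝ := fun r => max (u r) 0 with hm
  have hm0 : ∀ r, 0 ≤ m r := fun r => le_max_right _ _
  have hum : ∀ r, u r ≤ m r := fun r => le_max_left _ _
  have hstep : ∀ r, m (r + 1) ≤ (1 - ρ) * m r + v r := by
    intro r
    have h1 : (1 - ρ) * u r ≤ (1 - ρ) * m r :=
      mul_le_mul_of_nonneg_left (hum r) (by linarith)
    have h2 : 0 ≤ (1 - ρ) * m r := mul_nonneg (by linarith) (hm0 r)
    exact max_le (by linarith [hu r]) (by linarith [hv r])
  have key : ∀ n, ρ * ∑ r ∈ Finset.range n, m r + m n ≤ ∑ r ∈ Finset.range n, v r := by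
    intro n
    induction n with
    | zero => simpa [hm] using h0
    | succ n ih =>
      rw [Finset.sum_range_succ, Finset.sum_range_succ]
      linarith [hstep n]
  calc ρ * ∑ r ∈ Finset.range (n + 1), u r ≤ ρ * ∑ r ∈ Finset.range (n + 1), m r :=
        mul_le_mul_of_nonneg_left (Finset.sum_le_sum fun r _ => hum r) hρ
    _ = ρ * ∑ r ∈ Finset.range n, m r + ρ * m n := by rw [Finset.sum_range_succ, mul_add]
    _ ≤ ρ * ∑ r ∈ Finset.range n, m r + m n := by
        have := mul_le_mul_of_nonneg_right hρ1 (hm0 n)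
        linarith
    _ ≤ _ := key n

/-- Each term is reduced to (η/L) SG up to noise, with total coefficient 1/2 + 1 + 1 + 1 = 7/2, and
(η/L) SG ≤ 4D + 8ηRε by the descent bound. -/
theorem young_remainder_le {p η L B τ ν D ε R SE SG : ℝ} (hp : 0 < p) (hη : 0 < η) (hL : 0 < L)
    (hR : 0 ≤ R) (hh : L * η ≤ 1 / 2) (hhA : (L * η) ^ 2 * (2 * B / p) ≤ p ^ 2)
    (hτR : τ ^ 2 * R ≤ p ^ 2) (hν : ν ≤ L * ε) (hhν : (L * η) ^ 2 * ν ≤ p ^ 2 * (L * ε))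
    (hG0 : 0 ≤ SG) (hSE : SE ≤ 2 * R * ν + 2 * B / p * SG)
    (hSG : η * SG ≤ 4 * (L * D) + 8 * η * R * ν) :
    D + η ^ 2 * SG + 2 * η / p * (η * (L * η / p / 2 * SE +
      1 / (2 * (L * η / p)) * SG) + τ * (2 * η * τ * R / p / 2) * SG) ≤
      15 * D + 30 * η * R * ε := by
  have e1 : D + η ^ 2 * SG + 2 * η / p * (η * (L * η / p / 2 * SE +
      1 / (2 * (L * η / p)) * SG) + τ * (2 * η * τ * R / p / 2) * SG) =
      D + η / L * (L * η * SG + (L * η) ^ 2 / p ^ 2 * SE + SG +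
        2 * (L * η) * (τ ^ 2 * R / p ^ 2) * SG) := by
    field_simp
    ring
  have e2 : (L * η) ^ 2 / p ^ 2 * SE ≤ 2 * R * (L * ε) + SG := by
    have hp2 : 0 < p ^ 2 := by positivity
    rw [div_mul_eq_mul_div, div_le_iff₀ hp2]
    have i1 := mul_le_mul_of_nonneg_left hSE (sq_nonneg (L * η))
    have i2 := mul_le_mul_of_nonneg_right hhA hG0
    have i3 := mul_le_mul_of_nonneg_left hhν (by positivity : 0 ≤ 2 * R)
    linarith
  have e3 : τ ^ 2 * R / p ^ 2 ≤ 1 := (div_le_one (by positivity)).2 hτR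
  have e4 : 2 * (L * η) * (τ ^ 2 * R / p ^ 2) * SG ≤ SG := by
    have : 2 * (L * η) * (τ ^ 2 * R / p ^ 2) ≤ 1 * 1 :=
      mul_le_mul (by linarith) e3 (by positivity) zero_le_one
    simpa using mul_le_mul_of_nonneg_right this hG0
  have e5 := mul_le_mul_of_nonneg_right hh hG0
  have e6 : η / L * (L * η * SG + (L * η) ^ 2 / p ^ 2 * SE + SG +
      2 * (L * η) * (τ ^ 2 * R / p ^ 2) * SG) ≤ η / L * (2 * R * (L * ε) + 7 / 2 * SG) :=
    mul_le_mul_of_nonneg_left (by linarith) (by positivity)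
  have e7 : η / L * SG ≤ 4 * D + 8 * η * R * ε := by
    rw [div_mul_eq_mul_div, div_le_iff₀ hL]
    have := mul_le_mul_of_nonneg_left hν (by positivity : 0 ≤ 8 * η * R)
    linarith
  have e8 : η / L * (2 * R * (L * ε) + 7 / 2 * SG) =
      2 * η * R * ε + 7 / 2 * (η / L * SG) := by
    field_simp
  linarith

/-- The recursive inequalities between the expected squared error `E`, squared step `G`,
optimality gap `F`, squared distance `X` to the minimizer and error correlation `c`. -/
structure GapRecursion (p η L B τ ν D : ℝ) (E G F X c : ℕ → ℝ) : Prop where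
  E_nonneg : ∀ r, 0 ≤ E r
  G_nonneg : ∀ r, 0 ≤ G r
  F_nonneg : ∀ r, 0 ≤ F r
  X_nonneg : ∀ r, 0 ≤ X r
  F_zero : F 0 ≤ L / 2 * D
  X_zero : X 0 = D
  F_succ : ∀ r, F (r + 1) ≤ F r - η / 4 * G r + η / 2 * E r
  X_succ : ∀ r, X (r + 1) ≤ X r - 2 * η * F r - 2 * η * c r + η ^ 2 * G r
  E_zero : E 0 ≤ 2 * ν
  E_succ : ∀ r, E (r + 1) ≤ (1 - p / 2) * E r + p * ν + B * G r
  c_zero : c 0 = 0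
  c_succ : ∀ r (s t : ℝ), 0 < s → 0 < t →
    |c (r + 1)| ≤ (1 - p) * |c r| + (η * (s / 2 * E r + 1 / (2 * s) * G r) +
      τ * (t / 2 * G r + 1 / (2 * t) * X (r + 1)))

namespace GapRecursion

variable {p η L B τ ν D : ℝ} {E G F X c : ℕ → ℝ}

theorem sum_E_le (H : GapRecursion p η L B τ ν D E G F X c) (hp : 0 < p) (hp1 : p ≤ 1)
    (hB : 0 ≤ B) (R : ℕ) :
    ∑ r ∈ Finset.range R, E r ≤ 2 * R * ν + 2 * B / p * ∑ r ∈ Finset.range R, G r := by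
  rcases R with _ | n
  · simp
  -- The level 2ν is the fixed point of x ↦ (1 - p/2) x + pν, so subtracting it removes the constant
  -- forcing.
  have h1 := mul_sum_le_of_contraction (u := fun r => E r - 2 * ν) (v := fun r => B * G r)
    (ρ := p / 2) (by linarith) (fun r => mul_nonneg hB (H.G_nonneg r)) (by linarith [H.E_zero])
    (fun r => by linarith [H.E_succ r]) (by linarith) n
  have h2 : ∑ r ∈ Finset.range n, B * G r ≤ B * ∑ r ∈ Finset.range (n + 1), G r := by
    rw [← Finset.mul_sum, Finset.sum_range_succ]
    exact mul_le_mul_of_nonneg_left (by linarith [H.G_nonneg n]) hB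
  rw [Finset.sum_sub_distrib, Finset.sum_const, Finset.card_range, nsmul_eq_mul] at h1
  have h3 := h1.trans h2
  have h4 : 2 * B / p * ∑ r ∈ Finset.range (n + 1), G r =
      (B * ∑ r ∈ Finset.range (n + 1), G r) / (p / 2) := by
    field_simp
  rw [h4]
  have h5 := (le_div_iff₀' (by linarith : 0 < p / 2)).2 h3
  linarith

theorem F_telescope (H : GapRecursion p η L B τ ν D E G F X c) (R : ℕ) :
    F R ≤ F 0 - η / 4 * ∑ r ∈ Finset.range R, G r + η / 2 * ∑ r ∈ Finset.range R, E r := by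
  induction R with
  | zero => simp
  | succ n ih =>
    rw [Finset.sum_range_succ, Finset.sum_range_succ]
    linarith [H.F_succ n]

theorem X_telescope (H : GapRecursion p η L B τ ν D E G F X c) (hη : 0 < η) (n : ℕ) :
    X n + 2 * η * ∑ r ∈ Finset.range n, F r ≤
      D + 2 * η * ∑ r ∈ Finset.range n, |c r| + η ^ 2 * ∑ r ∈ Finset.range n, G r := by
  induction n with
  | zero => simp [H.X_zero]
  | succ n ih =>
    simp only [Finset.sum_range_succ]
    have := mul_le_mul_of_nonneg_left (neg_abs_le (c n)) (by linarith : 0 ≤ 2 * η)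
    linarith [H.X_succ n]

/-- With 2B/p ≤ 1/4 the accumulated error uses up only half of the decrease -η/4 ∑ G in the
telescoped descent inequality. -/
theorem sum_G_le (H : GapRecursion p η L B τ ν D E G F X c) (hp : 0 < p) (hp1 : p ≤ 1)
    (hB : 0 ≤ B) (hη : 0 < η) (hA : 2 * B / p ≤ 1 / 4) (R : ℕ) :
    η * ∑ r ∈ Finset.range R, G r ≤ 4 * (L * D) + 8 * η * R * ν := by
  have h1 := H.F_telescope R
  have h2 := H.sum_E_le hp hp1 hB R
  have hG : 0 ≤ ∑ r ∈ Finset.range R, G r := Finset.sum_nonneg fun r _ => H.G_nonneg r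
  have h3 := mul_le_mul_of_nonneg_right hA hG
  have h4 := mul_le_mul_of_nonneg_left (h2.trans (add_le_add_right h3 _)) hη.le
  linarith [H.F_nonneg R, H.F_zero]

/-- The bound on the distances before the Young parameters are chosen. -/
theorem X_add_sum_F_le (H : GapRecursion p η L B τ ν D E G F X c) (hp : 0 < p) (hp1 : p ≤ 1)
    (hη : 0 < η) (hτ : 0 ≤ τ) {s t : ℝ} (hs : 0 < s) (ht : 0 < t) {R n : ℕ} (hn : n < R) :
    X (n + 1) + 2 * η * ∑ r ∈ Finset.range (n + 1), F r ≤
      D + η ^ 2 * ∑ r ∈ Finset.range R, G r +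
      2 * η / p * (η * (s / 2 * ∑ r ∈ Finset.range R, E r +
        1 / (2 * s) * ∑ r ∈ Finset.range R, G r) + τ * (t / 2) * ∑ r ∈ Finset.range R, G r) +
      η * τ / (p * t) * ∑ r ∈ Finset.range n, X (r + 1) := by
  have hsub : ∀ {m : ℕ} {w : ℕ → ℝ}, (∀ r, 0 ≤ w r) → m ≤ R →
      ∑ r ∈ Finset.range m, w r ≤ ∑ r ∈ Finset.range R, w r := fun hw hm =>
    Finset.sum_le_sum_of_subset_of_nonneg (Finset.range_mono hm) fun r _ _ => hw r
  -- The sum of |c r| over r ≤ n is bounded through X 1, …, X n only; X (n + 1) does not appear on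
  -- the right, so the result can be used inductively.
  have h1 := mul_sum_le_of_contraction (u := fun r => |c r|)
    (v := fun r => η * (s / 2 * E r + 1 / (2 * s) * G r) +
      τ * (t / 2 * G r + 1 / (2 * t) * X (r + 1))) (ρ := p) hp1
    (fun r => by
      have := H.E_nonneg r
      have := H.G_nonneg r
      have := H.X_nonneg (r + 1)
      positivity)
    (by simp [H.c_zero]) (fun r => H.c_succ r s t hs ht) hp.le n
  have h2 : ∑ r ∈ Finset.range n, (η * (s / 2 * E r + 1 / (2 * s) * G r) +
      τ * (t / 2 * G r + 1 / (2 * t) * X (r + 1))) =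
      η * (s / 2 * ∑ r ∈ Finset.range n, E r + 1 / (2 * s) * ∑ r ∈ Finset.range n, G r) +
      τ * (t / 2) * ∑ r ∈ Finset.range n, G r +
      τ / (2 * t) * ∑ r ∈ Finset.range n, X (r + 1) := by
    simp only [Finset.mul_sum, ← Finset.sum_add_distrib]
    exact Finset.sum_congr rfl fun r _ => by ring
  rw [h2] at h1
  have hE := hsub H.E_nonneg hn.le
  have hG := hsub H.G_nonneg hn.le
  have h3 : p * ∑ r ∈ Finset.range (n + 1), |c r| ≤
      η * (s / 2 * ∑ r ∈ Finset.range R, E r + 1 / (2 * s) * ∑ r ∈ Finset.range R, G r) +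
      τ * (t / 2) * ∑ r ∈ Finset.range R, G r +
      τ / (2 * t) * ∑ r ∈ Finset.range n, X (r + 1) := h1.trans (by gcongr)
  have h4 := (le_div_iff₀' hp).2 h3
  have h5 := H.X_telescope hη (n + 1)
  have h6 := mul_le_mul_of_nonneg_left h4 (by linarith : 0 ≤ 2 * η)
  have h7 := mul_le_mul_of_nonneg_left (hsub H.G_nonneg hn) (sq_nonneg η)
  refine (h5.trans (add_le_add (add_le_add_right h6 D) h7)).trans_eq ?_
  field_simp
  ring

/-- The correlation bound involves the distances themselves. They are first shown to stay below 2Q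
by strong induction, and the same inequality then bounds the gaps. -/
theorem sum_F_le (H : GapRecursion p η L B τ ν D E G F X c) (hp : 0 < p) (hp1 : p ≤ 1)
    (hη : 0 < η) (hL : 0 < L) (hB : 0 ≤ B) (hτ : 0 < τ) (hD : 0 ≤ D) {ε : ℝ} {R : ℕ} (hR : 1 ≤ R)
    (hh : L * η ≤ 1 / 2) (hA : 2 * B / p ≤ 1 / 4) (hhA : (L * η) ^ 2 * (2 * B / p) ≤ p ^ 2)
    (hτR : τ ^ 2 * R ≤ p ^ 2) (hν : ν ≤ L * ε) (hhν : (L * η) ^ 2 * ν ≤ p ^ 2 * (L * ε)) :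
    ∑ r ∈ Finset.range R, F r ≤ 15 * (D / η) + 30 * R * ε := by
  have hR' : (0 : ℝ) < R := by positivity
  have hSE := H.sum_E_le hp hp1 hB R
  have hSG := H.sum_G_le hp hp1 hB hη hA R
  have hE0 : 0 ≤ ∑ r ∈ Finset.range R, E r := Finset.sum_nonneg fun r _ => H.E_nonneg r
  have hG0 : 0 ≤ ∑ r ∈ Finset.range R, G r := Finset.sum_nonneg fun r _ => H.G_nonneg r
  -- This weight turns the ‖g‖² part of the first Young term into exactly (η/L) SG, the size that
  -- the descent bound controls by D.
  have hs : 0 < L * η / p := by positivity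
  -- This weight gives each X a coefficient 1/(2R), so fewer than R of them, each at most 2Q,
  -- contribute at most Q.
  have ht : 0 < 2 * η * τ * R / p := by positivity
  have key := fun n (hn : n < R) => H.X_add_sum_F_le hp hp1 hη hτ.le hs ht hn
  set SE := ∑ r ∈ Finset.range R, E r
  set SG := ∑ r ∈ Finset.range R, G r
  set Q : ℝ := D + η ^ 2 * SG + 2 * η / p * (η * (L * η / p / 2 * SE +
    1 / (2 * (L * η / p)) * SG) + τ * (2 * η * τ * R / p / 2) * SG) with hQ
  have hQ0 : 0 ≤ Q := by positivity
  have hcoef : η * τ / (p * (2 * η * τ * R / p)) = 1 / (2 * R) := by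
    field_simp
  rw [hcoef] at key
  have hsumF : ∀ n, 0 ≤ 2 * η * ∑ r ∈ Finset.range n, F r := fun n =>
    mul_nonneg (by linarith) (Finset.sum_nonneg fun r _ => H.F_nonneg r)
  have hXsum : ∀ n, n < R → (∀ r < n, X (r + 1) ≤ 2 * Q) →
      1 / (2 * (R : ℝ)) * ∑ r ∈ Finset.range n, X (r + 1) ≤ Q := by
    intro n hn hX
    have h1 : ∑ r ∈ Finset.range n, X (r + 1) ≤ R * (2 * Q) := by
      refine (Finset.sum_le_sum fun r hr => hX r (Finset.mem_range.1 hr)).trans ?_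
      rw [Finset.sum_const, Finset.card_range, nsmul_eq_mul]
      have : (n : ℝ) ≤ R := by exact_mod_cast hn.le
      gcongr
    calc _ ≤ 1 / (2 * (R : ℝ)) * (R * (2 * Q)) := by gcongr
      _ = Q := by field_simp
  have hX : ∀ n, n < R → X (n + 1) ≤ 2 * Q := by
    intro n
    induction n using Nat.strong_induction_on with
    | _ n ih =>
      intro hn
      have h1 := hXsum n hn fun r hr => ih r hr (hr.trans hn)
      linarith [key n hn, hsumF (n + 1)]
  obtain ⟨n, rfl⟩ : ∃ n, R = n + 1 := ⟨R - 1, by omega⟩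
  have hn : n < n + 1 := n.lt_succ_self
  have h1 := hXsum n hn fun r hr => hX r (hr.trans hn)
  have h2 : η * ∑ r ∈ Finset.range (n + 1), F r ≤ Q := by
    linarith [key n hn, H.X_nonneg (n + 1)]
  have hQ' : Q ≤ 15 * D + 30 * η * (n + 1 : ℕ) * ε :=
    young_remainder_le hp hη hL hR'.le hh hhA hτR hν hhν hG0 hSE hSG
  have h3 := (le_div_iff₀' hη).2 (h2.trans hQ')
  refine h3.trans_eq ?_
  field_simp

/-- The index is shifted by one descent step, which costs at most η/2 ∑ E; this avoids a separate
estimate of the last gap. -/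
theorem sum_F_succ_le (H : GapRecursion p η L B τ ν D E G F X c) (hp : 0 < p) (hp1 : p ≤ 1)
    (hη : 0 < η) (hL : 0 < L) (hB : 0 ≤ B) (hτ : 0 < τ) (hD : 0 ≤ D) {ε : ℝ} (hε : 0 ≤ ε)
    {R : ℕ} (hR : 1 ≤ R)
    (hh : L * η ≤ 1 / 2) (hA : 2 * B / p ≤ 1 / 4) (hhA : (L * η) ^ 2 * (2 * B / p) ≤ p ^ 2)
    (hτR : τ ^ 2 * R ≤ p ^ 2) (hν : ν ≤ L * ε) (hhν : (L * η) ^ 2 * ν ≤ p ^ 2 * (L * ε)) :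
    ∑ r ∈ Finset.range R, F (r + 1) ≤ 16 * (D / η) + 32 * R * ε := by
  have h1 := H.sum_F_le hp hp1 hη hL hB hτ hD hR hh hA hhA hτR hν hhν
  have hSE := H.sum_E_le hp hp1 hB R
  have hSG := H.sum_G_le hp hp1 hB hη hA R
  have hG0 : 0 ≤ ∑ r ∈ Finset.range R, G r := Finset.sum_nonneg fun r _ => H.G_nonneg r
  have h2 : ∑ r ∈ Finset.range R, F (r + 1) ≤
      ∑ r ∈ Finset.range R, F r + η / 2 * ∑ r ∈ Finset.range R, E r := by
    rw [Finset.mul_sum, ← Finset.sum_add_distrib]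
    refine Finset.sum_le_sum fun r _ => ?_
    have := mul_nonneg hη.le (H.G_nonneg r)
    linarith [H.F_succ r]
  have h3 := mul_le_mul_of_nonneg_right hA hG0
  have h4 := mul_le_mul_of_nonneg_left (hSE.trans (add_le_add_right h3 _)) hη.le
  have h5 : η * (R * ν) ≤ 1 / 2 * (R * ε) := by
    have i1 := mul_le_mul_of_nonneg_left hν (by positivity : 0 ≤ η * (R : ℝ))
    have i2 := mul_le_mul_of_nonneg_right hh (by positivity : 0 ≤ (R : ℝ) * ε)
    linarith
  have h6 : L * D ≤ 1 / 2 * (D / η) := by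
    rw [← mul_div_assoc, le_div_iff₀ hη]
    have := mul_le_mul_of_nonneg_right hh hD
    linarith
  have h7 : 0 ≤ D / η := by positivity
  have h8 : 0 ≤ R * ε := by positivity
  linarith

end GapRecursion

end Sequences

/-! ### Deterministic inequalities for one step. -/

section Pointwise

variable {d : ℕ} {L η : ℝ} {φ : Vec d → ℝ} {s : State d}

/-- By polarisation ⟨∇φ, g⟩ = (‖g‖² + ‖∇φ‖² - ‖g - ∇φ‖²)/2, and Lη ≤ 1/2 lets half of -η/2 ‖g‖²
absorb the quadratic term. -/
theorem LSmooth.descent (hφ : LSmooth L φ) (hη : 0 ≤ η) (hh : L * η ≤ 1 / 2)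
    (hs : s.x = s.xPrev - η • s.gPrev) :
    φ s.x ≤ φ s.xPrev - η / 4 * ‖s.gPrev‖ ^ 2 +
      η / 2 * ‖s.gPrev - gradient φ s.xPrev‖ ^ 2 := by
  have h1 := hφ.le_quadratic s.xPrev (-(η • s.gPrev))
  rw [← sub_eq_add_neg, ← hs, norm_neg, norm_smul, Real.norm_of_nonneg hη, inner_neg_right,
    real_inner_smul_right] at h1
  have h2 := norm_sub_sq_real s.gPrev (gradient φ s.xPrev)
  rw [real_inner_comm] at h2
  have h3 : 0 ≤ η * ‖gradient φ s.xPrev‖ ^ 2 := by positivity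
  have h4 := mul_le_mul_of_nonneg_right hh (by positivity : 0 ≤ η * ‖s.gPrev‖ ^ 2)
  rw [h2]
  linarith

theorem ConvexOn.dist_sq_step (hd : Differentiable ℝ φ) (hc : ConvexOn ℝ Set.univ φ)
    (hη : 0 ≤ η) (hs : s.x = s.xPrev - η • s.gPrev) (xstar : Vec d) :
    ‖s.x - xstar‖ ^ 2 ≤ ‖s.xPrev - xstar‖ ^ 2 - 2 * η * (φ s.xPrev - φ xstar) -
      2 * η * inner ℝ (s.gPrev - gradient φ s.xPrev) (s.xPrev - xstar) +
      η ^ 2 * ‖s.gPrev‖ ^ 2 := by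
  have h1 := ConvexOn.gradient_inequality hd hc s.xPrev xstar
  have h2 := norm_sub_sq_real (s.xPrev - xstar) (η • s.gPrev)
  rw [norm_smul, Real.norm_of_nonneg hη, real_inner_smul_right, real_inner_comm] at h2
  have h3 : s.x - xstar = s.xPrev - xstar - η • s.gPrev := by rw [hs]; abel
  rw [← neg_sub s.xPrev xstar, inner_neg_right] at h1
  have h4 := mul_le_mul_of_nonneg_left h1 hη
  rw [h3, h2, inner_sub_left]
  linarith

theorem norm_mul_norm_le_young {E : Type*} [NormedAddCommGroup E] (u v : E)
    {t : ℝ} (ht : 0 < t) : ‖u‖ * ‖v‖ ≤ t / 2 * ‖u‖ ^ 2 + 1 / (2 * t) * ‖v‖ ^ 2 := by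
  have h2 : t / 2 * ‖u‖ ^ 2 + 1 / (2 * t) * ‖v‖ ^ 2 - ‖u‖ * ‖v‖ =
      (t * ‖u‖ - ‖v‖) ^ 2 / (2 * t) := by
    field_simp
    ring
  have h3 : 0 ≤ (t * ‖u‖ - ‖v‖) ^ 2 / (2 * t) := by positivity
  linarith

end Pointwise

/-! ### From one-round estimates to the recursion in expectation. -/

section Trajectory

variable {d N S M K b₁ b₂ b₃ : ℕ} {L ηg ηl p v : ℝ} {f : Fin N → Fin M → Vec d → ℝ}
  {x₀ xstar : Vec d}

theorem mul_norm_step_le (hη : 0 ≤ ηg) (hh : L * ηg ≤ 1 / 2) {s : State d}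
    (hs : s.x = s.xPrev - ηg • s.gPrev) :
    L * ‖s.x - s.xPrev‖ = L * ηg * ‖s.gPrev‖ ∧ L * ‖s.x - s.xPrev‖ ≤ ‖s.gPrev‖ := by
  have h1 : L * ‖s.x - s.xPrev‖ = L * ηg * ‖s.gPrev‖ := by
    rw [hs, sub_sub_cancel_left, norm_neg, norm_smul, Real.norm_of_nonneg hη, mul_assoc]
  refine ⟨h1, h1.le.trans ?_⟩
  have := mul_le_mul_of_nonneg_right hh (norm_nonneg s.gPrev)
  linarith [norm_nonneg s.gPrev]

theorem roundMean_error_le (hK : 1 ≤ K) (hS : 1 ≤ S) (hSN : S ≤ N) (h₁ : 1 ≤ b₁) (h₁M : b₁ ≤ M)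
    (h₂ : 1 ≤ b₂) (h₂M : b₂ ≤ M) (h₃ : b₃ ≤ M) (hL : 0 ≤ L) (hηg : 0 ≤ ηg) (hη : 0 < ηl)
    (hf : ∀ i j, LSmooth L (f i j)) (hu : 2 * (L * ηl) * K ≤ 1) (hh : L * ηg ≤ 1 / 2)
    (hp : 0 < p) (hp1 : p ≤ 1) {s : State d} (hs : s.x = s.xPrev - ηg • s.gPrev)
    (hv : ∀ i, avg (fun I : Batch M b₁ =>
      ‖batchGrad (f i) I.1 s.x - gradient (clientLoss (f i)) s.x‖ ^ 2) ≤ v) :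
    roundMean p (fun c (z : RoundDraw N S M K b₁ b₂ b₃) =>
      ‖serverGrad f ηl c z s - gradient (globalLoss f) s.x‖ ^ 2) ≤
      (1 - p / 2) * ‖s.gPrev - gradient (globalLoss f) s.xPrev‖ ^ 2 + p * (v / N) +
        ((L * ηg) ^ 2 / S + 2 * (4 * (L * ηl) * K) ^ 2 / p) * ‖s.gPrev‖ ^ 2 := by
  obtain ⟨hs1, hs2⟩ := mul_norm_step_le hηg hh hs
  have ht := avg_norm_serverGrad_true_sq_le (K := K) (ηl := ηl) (hS.trans hSN) hSN h₁ h₁M h₂M h₃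
    (fun i j => (hf i j).1) s hv
  -- The Young weight p/2 gives up half of the contraction, as (1 - p)(1 + p/2) ≤ 1 - p/2, and
  -- charges the squared drift with a factor at most 2/p.
  have hfa := avg_norm_serverGrad_false_sq_le hK hS hSN h₁M h₂ h₂M h₃ hL hη hf hu hs2
    (t := p / 2) (by positivity)
  rw [hs1, mul_pow, mul_pow _ ‖s.gPrev‖] at hfa
  unfold roundMean
  have hS' : (0 : ℝ) < S := by positivity
  set e := ‖s.gPrev - gradient (globalLoss f) s.xPrev‖ ^ 2
  set g := ‖s.gPrev‖ ^ 2
  set τ := 4 * (L * ηl) * K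
  have he : 0 ≤ e := by positivity
  have hg : 0 ≤ g := by positivity
  have i1 := mul_le_mul_of_nonneg_left ht hp.le
  have i2 := mul_le_mul_of_nonneg_left hfa (by linarith : 0 ≤ 1 - p)
  have i3 : (1 - p) * (1 + p / 2) ≤ 1 - p / 2 := by nlinarith
  have i4 : (1 - p) * (1 + 1 / (p / 2)) ≤ 2 / p := by
    rw [le_div_iff₀ hp]
    field_simp
    nlinarith
  have j1 := mul_le_mul_of_nonneg_right i3 he
  have j2 := mul_le_mul_of_nonneg_right (i3.trans (by linarith : 1 - p / 2 ≤ 1))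
    (by positivity : 0 ≤ (L * ηg) ^ 2 * g / S)
  have j3 := mul_le_mul_of_nonneg_right i4 (by positivity : 0 ≤ τ ^ 2 * g)
  have e1 : ((L * ηg) ^ 2 / S + 2 * τ ^ 2 / p) * g =
      1 * ((L * ηg) ^ 2 * g / S) + 2 / p * (τ ^ 2 * g) := by ring
  rw [e1]
  linarith

/-- Full rounds contribute zero, hence the factor 1 - p. In the other rounds the old error is tested
against x - x^* instead of xPrev - x^*, which costs ηg ⟨e, gPrev⟩. -/
theorem abs_roundMean_inner_sub_le (hK : 1 ≤ K) (hS : 1 ≤ S) (hSN : S ≤ N) (h₁ : 1 ≤ b₁)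
    (h₁M : b₁ ≤ M) (h₂ : 1 ≤ b₂) (h₂M : b₂ ≤ M) (h₃ : b₃ ≤ M) (hL : 0 ≤ L) (hηg : 0 ≤ ηg)
    (hη : 0 < ηl) (hf : ∀ i j, LSmooth L (f i j)) (hu : 2 * (L * ηl) * K ≤ 1)
    (hh : L * ηg ≤ 1 / 2) (hp : 0 < p) (hp1 : p ≤ 1) {s : State d}
    (hs : s.x = s.xPrev - ηg • s.gPrev) {t t' : ℝ} (ht : 0 < t) (ht' : 0 < t') :
    |roundMean p (fun c (z : RoundDraw N S M K b₁ b₂ b₃) =>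
      inner ℝ (serverGrad f ηl c z s - gradient (globalLoss f) s.x) (s.x - xstar)) -
      (1 - p) * inner ℝ (s.gPrev - gradient (globalLoss f) s.xPrev) (s.xPrev - xstar)| ≤
      ηg * (t / 2 * ‖s.gPrev - gradient (globalLoss f) s.xPrev‖ ^ 2 +
        1 / (2 * t) * ‖s.gPrev‖ ^ 2) +
      4 * (L * ηl) * K * (t' / 2 * ‖s.gPrev‖ ^ 2 + 1 / (2 * t') * ‖s.x - xstar‖ ^ 2) := by
  obtain ⟨-, hs2⟩ := mul_norm_step_le hηg hh hs
  have hfa := abs_avg_inner_serverGrad_false_sub_le hK hS hSN h₁M h₂ h₂M h₃ hL hη hf hu hs2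
    (s.x - xstar)
  unfold roundMean
  rw [avg_inner_serverGrad_true hSN h₁ h₁M h₂M h₃ (fun i j => (hf i j).1), mul_zero, zero_add,
    ← mul_sub, abs_mul, abs_of_nonneg (by linarith : 0 ≤ 1 - p)]
  set a := avg (fun z : RoundDraw N S M K b₁ b₂ b₃ =>
    inner ℝ (serverGrad f ηl false z s - gradient (globalLoss f) s.x) (s.x - xstar))
  set e := s.gPrev - gradient (globalLoss f) s.xPrev
  have h4 : s.x - xstar = (s.xPrev - xstar) - ηg • s.gPrev := by rw [hs]; abel
  have h5 : inner ℝ e (s.x - xstar) = inner ℝ e (s.xPrev - xstar) - ηg * inner ℝ e s.gPrev := by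
    rw [h4, inner_sub_right, real_inner_smul_right]
  have h6 : |a - inner ℝ e (s.xPrev - xstar)| ≤
      |a - inner ℝ e (s.x - xstar)| + ηg * |inner ℝ e s.gPrev| := by
    have : a - inner ℝ e (s.xPrev - xstar) =
        (a - inner ℝ e (s.x - xstar)) + -(ηg * inner ℝ e s.gPrev) := by rw [h5]; ring
    rw [this]
    refine (abs_add_le _ _).trans ?_
    rw [abs_neg, abs_mul, abs_of_nonneg hηg]
  have h7 := mul_le_mul_of_nonneg_left
    ((abs_real_inner_le_norm e s.gPrev).trans (norm_mul_norm_le_young e s.gPrev ht)) hηg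
  have h8 := mul_le_mul_of_nonneg_left (norm_mul_norm_le_young s.gPrev (s.x - xstar) ht')
    (by positivity : 0 ≤ 4 * (L * ηl) * K)
  have h9 : (1 - p) * |a - inner ℝ e (s.xPrev - xstar)| ≤ |a - inner ℝ e (s.xPrev - xstar)| :=
    mul_le_of_le_one_left (abs_nonneg _) (by linarith)
  linarith

variable {Ω : Type*} [MeasurableSpace Ω] {μ : Measure Ω} [IsProbabilityMeasure μ]
  {q : ℕ → Ω → Bool} {Z : ℕ → Ω → RoundDraw N S M K b₁ b₂ b₃}

/-- The expectations along a run of FedPAGE satisfy the gap recursion. -/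
theorem IsSampling.gapRecursion
    (hsamp : IsSampling μ (fun r => if r = 0 then 1 else p) q Z)
    (hK : 1 ≤ K) (hS : 1 ≤ S) (hSN : S ≤ N) (h₁ : 1 ≤ b₁)
    (h₁M : b₁ ≤ M) (h₂ : 1 ≤ b₂) (h₂M : b₂ ≤ M) (h₃ : b₃ ≤ M) (hL : 0 ≤ L) (hηg : 0 ≤ ηg)
    (hη : 0 < ηl) (hf : ∀ i j, LSmooth L (f i j)) (hc : ConvexOn ℝ Set.univ (globalLoss f))
    (hmin : ∀ x, globalLoss f xstar ≤ globalLoss f x) (hu : 2 * (L * ηl) * K ≤ 1)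
    (hh : L * ηg ≤ 1 / 2) (hp : 0 < p) (hp1 : p ≤ 1)
    (hv : ∀ i x, avg (fun I : Batch M b₁ =>
      ‖batchGrad (f i) I.1 x - gradient (clientLoss (f i)) x‖ ^ 2) ≤ v) :
    GapRecursion p ηg L ((L * ηg) ^ 2 / S + 2 * (4 * (L * ηl) * K) ^ 2 / p) (4 * (L * ηl) * K)
      (v / N) (‖x₀ - xstar‖ ^ 2)
      (fun r => ∫ ω, ‖(stateAt f ηg ηl x₀ q Z (r + 1) ω).gPrev -
        gradient (globalLoss f) (stateAt f ηg ηl x₀ q Z (r + 1) ω).xPrev‖ ^ 2 ∂μ)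
      (fun r => ∫ ω, ‖(stateAt f ηg ηl x₀ q Z (r + 1) ω).gPrev‖ ^ 2 ∂μ)
      (fun r => ∫ ω, (globalLoss f (stateAt f ηg ηl x₀ q Z r ω).x - globalLoss f xstar) ∂μ)
      (fun r => ∫ ω, ‖(stateAt f ηg ηl x₀ q Z r ω).x - xstar‖ ^ 2 ∂μ)
      (fun r => ∫ ω, inner ℝ ((stateAt f ηg ηl x₀ q Z (r + 1) ω).gPrev -
        gradient (globalLoss f) (stateAt f ηg ηl x₀ q Z (r + 1) ω).xPrev)
          ((stateAt f ηg ηl x₀ q Z (r + 1) ω).xPrev - xstar) ∂μ) := by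
  have := RoundDraw.nonempty (K := K) hSN h₁M h₂M h₃
  have hI := fun r (Φ : State d → ℝ) =>
    hsamp.integrable_stateAt (f := f) (ηg := ηg) (ηl := ηl) (x₀ := x₀) r Φ
  have hround := fun r H =>
    hsamp.integral_round (f := f) (ηg := ηg) (ηl := ηl) (x₀ := x₀) r H
  have hsm := globalLoss_lsmooth hL hf
  -- The state before round r + 1 stores x^r, x^{r+1} and g^r, so all quantities of round r are read
  -- off at index r + 1.
  have hstep : ∀ r ω, (stateAt f ηg ηl x₀ q Z (r + 1) ω).x =
      (stateAt f ηg ηl x₀ q Z (r + 1) ω).xPrev -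
        ηg • (stateAt f ηg ηl x₀ q Z (r + 1) ω).gPrev := fun r ω => rfl
  set φ := globalLoss f with hφ
  refine
    { E_nonneg := fun r => integral_nonneg fun ω => by positivity
      G_nonneg := fun r => integral_nonneg fun ω => by positivity
      F_nonneg := fun r => integral_nonneg fun ω => sub_nonneg.2 (hmin _)
      X_nonneg := fun r => integral_nonneg fun ω => by positivity
      F_zero := ?_
      X_zero := ?_
      F_succ := ?_
      X_succ := ?_
      E_zero := ?_
      E_succ := ?_
      c_zero := ?_
      c_succ := ?_ }
  · have h1 := hsm.sub_min_le xstar hmin x₀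
    simpa [stateAt, run] using h1
  · simp [stateAt, run]
  · intro r
    have h1 := integral_mono (hI (r + 1) fun s => φ s.x - φ xstar)
      (hI (r + 1) fun s => (φ s.xPrev - φ xstar) - ηg / 4 * ‖s.gPrev‖ ^ 2 +
        ηg / 2 * ‖s.gPrev - gradient φ s.xPrev‖ ^ 2)
      (fun ω => by
        have := hsm.descent hηg hh (hstep r ω)
        simp only
        linarith)
    rw [integral_add (hI (r + 1) fun s => (φ s.xPrev - φ xstar) - ηg / 4 * ‖s.gPrev‖ ^ 2)
      (hI (r + 1) fun s => ηg / 2 * ‖s.gPrev - gradient φ s.xPrev‖ ^ 2),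
      integral_sub (hI (r + 1) fun s => φ s.xPrev - φ xstar)
      (hI (r + 1) fun s => ηg / 4 * ‖s.gPrev‖ ^ 2), integral_const_mul, integral_const_mul] at h1
    exact h1
  · intro r
    have h1 := integral_mono (hI (r + 1) fun s => ‖s.x - xstar‖ ^ 2)
      (hI (r + 1) fun s => ‖s.xPrev - xstar‖ ^ 2 - 2 * ηg * (φ s.xPrev - φ xstar) -
        2 * ηg * inner ℝ (s.gPrev - gradient φ s.xPrev) (s.xPrev - xstar) +
        ηg ^ 2 * ‖s.gPrev‖ ^ 2)
      (fun ω => ConvexOn.dist_sq_step hsm.1 hc hηg (hstep r ω) xstar)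
    rw [integral_add (hI (r + 1) fun s => ‖s.xPrev - xstar‖ ^ 2 -
        2 * ηg * (φ s.xPrev - φ xstar) -
        2 * ηg * inner ℝ (s.gPrev - gradient φ s.xPrev) (s.xPrev - xstar))
      (hI (r + 1) fun s => ηg ^ 2 * ‖s.gPrev‖ ^ 2),
      integral_sub (hI (r + 1) fun s => ‖s.xPrev - xstar‖ ^ 2 - 2 * ηg * (φ s.xPrev - φ xstar))
      (hI (r + 1) fun s =>
        2 * ηg * inner ℝ (s.gPrev - gradient φ s.xPrev) (s.xPrev - xstar)),
      integral_sub (hI (r + 1) fun s => ‖s.xPrev - xstar‖ ^ 2)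
      (hI (r + 1) fun s => 2 * ηg * (φ s.xPrev - φ xstar)),
      integral_const_mul, integral_const_mul, integral_const_mul] at h1
    exact h1
  · have h1 := hround 0 fun s c z => ‖serverGrad f ηl c z s - gradient φ s.x‖ ^ 2
    have h2 := integral_mono (hI 0 fun s => roundMean (N := N) (S := S) (M := M) (K := K)
      (b₁ := b₁) (b₂ := b₂) (b₃ := b₃) 1
      fun c z => ‖serverGrad f ηl c z s - gradient φ s.x‖ ^ 2) (integrable_const (v / N))
      (fun ω => by
        simp only [roundMean, one_mul, sub_self, zero_mul, add_zero]
        exact avg_norm_serverGrad_true_sq_le (hS.trans hSN) hSN h₁ h₁M h₂M h₃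
          (fun i j => (hf i j).1) _ fun i => hv i _)
    have h3 : 0 ≤ ∫ ω, ‖(stateAt f ηg ηl x₀ q Z (0 + 1) ω).gPrev -
        gradient φ (stateAt f ηg ηl x₀ q Z (0 + 1) ω).xPrev‖ ^ 2 ∂μ :=
      integral_nonneg fun ω => by positivity
    simp only [if_true] at h1
    have h4 : ∫ ω, ‖(stateAt f ηg ηl x₀ q Z (0 + 1) ω).gPrev -
        gradient φ (stateAt f ηg ηl x₀ q Z (0 + 1) ω).xPrev‖ ^ 2 ∂μ ≤ v / N := by
      refine (h1.le.trans h2).trans_eq ?_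
      simp
    linarith
  · intro r
    have h1 := hround (r + 1) fun s c z => ‖serverGrad f ηl c z s - gradient φ s.x‖ ^ 2
    simp only [Nat.add_eq_zero_iff, one_ne_zero, and_false, if_false] at h1
    have h2 := integral_mono (hI (r + 1) fun s => roundMean (N := N) (S := S) (M := M) (K := K)
      (b₁ := b₁) (b₂ := b₂) (b₃ := b₃) p
      fun c z => ‖serverGrad f ηl c z s - gradient φ s.x‖ ^ 2)
      (hI (r + 1) fun s => (1 - p / 2) * ‖s.gPrev - gradient φ s.xPrev‖ ^ 2 + p * (v / N) +
        ((L * ηg) ^ 2 / S + 2 * (4 * (L * ηl) * K) ^ 2 / p) * ‖s.gPrev‖ ^ 2)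
      (fun ω => roundMean_error_le hK hS hSN h₁ h₁M h₂ h₂M h₃ hL hηg hη hf hu hh hp hp1
        (hstep r ω) fun i => hv i _)
    rw [integral_add (hI (r + 1) fun s =>
        (1 - p / 2) * ‖s.gPrev - gradient φ s.xPrev‖ ^ 2 + p * (v / N))
      (hI (r + 1) fun s =>
        ((L * ηg) ^ 2 / S + 2 * (4 * (L * ηl) * K) ^ 2 / p) * ‖s.gPrev‖ ^ 2),
      integral_add (hI (r + 1) fun s => (1 - p / 2) * ‖s.gPrev - gradient φ s.xPrev‖ ^ 2)
      (integrable_const _), integral_const, probReal_univ, one_smul,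
      integral_const_mul, integral_const_mul] at h2
    exact h1.le.trans h2
  · have h1 := hround 0 fun s c z => inner ℝ (serverGrad f ηl c z s - gradient φ s.x) (s.x - xstar)
    simp only [if_true, roundMean, one_mul, sub_self, zero_mul, add_zero] at h1
    refine h1.trans ?_
    simp only [avg_inner_serverGrad_true hSN h₁ h₁M h₂M h₃ (fun i j => (hf i j).1), hφ,
      integral_zero]
  · intro r t t' ht ht'
    have h1 := hround (r + 1) fun s c z =>
      inner ℝ (serverGrad f ηl c z s - gradient φ s.x) (s.x - xstar)
    simp only [Nat.add_eq_zero_iff, one_ne_zero, and_false, if_false] at h1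
    set rm : State d → ℝ := fun s => roundMean (N := N) (S := S) (M := M) (K := K)
      (b₁ := b₁) (b₂ := b₂) (b₃ := b₃) p fun c z =>
      inner ℝ (serverGrad f ηl c z s - gradient φ s.x) (s.x - xstar) with hrm
    have h2 := norm_integral_le_of_norm_le (μ := μ) (f := fun ω =>
        rm (stateAt f ηg ηl x₀ q Z (r + 1) ω) - (1 - p) *
          inner ℝ ((stateAt f ηg ηl x₀ q Z (r + 1) ω).gPrev -
            gradient φ (stateAt f ηg ηl x₀ q Z (r + 1) ω).xPrev)
              ((stateAt f ηg ηl x₀ q Z (r + 1) ω).xPrev - xstar))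
      (hI (r + 1) fun s => ηg * (t / 2 * ‖s.gPrev - gradient φ s.xPrev‖ ^ 2 +
        1 / (2 * t) * ‖s.gPrev‖ ^ 2) +
        4 * (L * ηl) * K * (t' / 2 * ‖s.gPrev‖ ^ 2 + 1 / (2 * t') * ‖s.x - xstar‖ ^ 2))
      (Filter.Eventually.of_forall fun ω => abs_roundMean_inner_sub_le hK hS hSN h₁ h₁M h₂ h₂M h₃
        hL hηg hη hf hu hh hp hp1 (hstep r ω) ht ht')
    rw [integral_sub (hI (r + 1) rm) (hI (r + 1) fun s =>
        (1 - p) * inner ℝ (s.gPrev - gradient φ s.xPrev) (s.xPrev - xstar)), integral_const_mul,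
      integral_add (hI (r + 1) fun s => ηg * (t / 2 * ‖s.gPrev - gradient φ s.xPrev‖ ^ 2 +
        1 / (2 * t) * ‖s.gPrev‖ ^ 2)) (hI (r + 1) fun s =>
        4 * (L * ηl) * K * (t' / 2 * ‖s.gPrev‖ ^ 2 + 1 / (2 * t') * ‖s.x - xstar‖ ^ 2)),
      integral_const_mul, integral_const_mul,
      integral_add (hI (r + 1) fun s => t / 2 * ‖s.gPrev - gradient φ s.xPrev‖ ^ 2)
      (hI (r + 1) fun s => 1 / (2 * t) * ‖s.gPrev‖ ^ 2),
      integral_add (hI (r + 1) fun s => t' / 2 * ‖s.gPrev‖ ^ 2)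
      (hI (r + 1) fun s => 1 / (2 * t') * ‖s.x - xstar‖ ^ 2),
      integral_const_mul, integral_const_mul, integral_const_mul, integral_const_mul,
      Real.norm_eq_abs] at h2
    have h3 := h1.trans (show _ = ∫ ω, rm (stateAt f ηg ηl x₀ q Z (r + 1) ω) ∂μ from rfl)
    rw [← h3] at h2
    have h4 := abs_sub_abs_le_abs_sub
      (∫ ω, inner ℝ (serverGrad f ηl (q (r + 1) ω) (Z (r + 1) ω)
        (stateAt f ηg ηl x₀ q Z (r + 1) ω) -
          gradient φ (stateAt f ηg ηl x₀ q Z (r + 1) ω).x)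
            ((stateAt f ηg ηl x₀ q Z (r + 1) ω).x - xstar) ∂μ)
      ((1 - p) * ∫ ω, inner ℝ ((stateAt f ηg ηl x₀ q Z (r + 1) ω).gPrev -
        gradient φ (stateAt f ηg ηl x₀ q Z (r + 1) ω).xPrev)
          ((stateAt f ηg ηl x₀ q Z (r + 1) ω).xPrev - xstar) ∂μ)
    rw [abs_mul, abs_of_nonneg (by linarith : 0 ≤ 1 - p)] at h4
    have h5 := sub_le_iff_le_add'.1 (h4.trans h2)
    exact h5

end Trajectory

/-! ### Size of the global step in terms of w = N^{1/4}. -/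

section Scales

variable {N S : ℕ} {L : ℝ}

theorem natCast_rpow_quarter (N : ℕ) (k : ℕ) :
    (N : ℝ) ^ ((k : ℝ) / 4) = ((N : ℝ) ^ (1 / 4 : ℝ)) ^ k := by
  rw [← Real.rpow_natCast, ← Real.rpow_mul (Nat.cast_nonneg N)]
  congr 1
  ring

theorem quarter_pow_four (N : ℕ) : ((N : ℝ) ^ (1 / 4 : ℝ)) ^ 4 = N := by
  rw [← natCast_rpow_quarter N 4]
  norm_num

theorem rpow_three_quarters (N : ℕ) :
    (N : ℝ) ^ (3 / 4 : ℝ) = ((N : ℝ) ^ (1 / 4 : ℝ)) ^ 3 := by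
  rw [← natCast_rpow_quarter N 3]
  norm_num

theorem rpow_five_quarters (N : ℕ) :
    (N : ℝ) ^ (5 / 4 : ℝ) = ((N : ℝ) ^ (1 / 4 : ℝ)) ^ 5 := by
  rw [← natCast_rpow_quarter N 5]
  norm_num

theorem sqrt_eq_quarter_sq (N : ℕ) : √(N : ℝ) = ((N : ℝ) ^ (1 / 4 : ℝ)) ^ 2 := by
  rw [← natCast_rpow_quarter N 2, Real.sqrt_eq_rpow]
  norm_num

theorem one_le_quarter (hN : 1 ≤ N) : 1 ≤ (N : ℝ) ^ (1 / 4 : ℝ) :=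
  Real.one_le_rpow (by exact_mod_cast hN) (by norm_num)

theorem globalStepScale_eq (N S : ℕ) (L : ℝ) :
    globalStepScale N S L = (((S : ℝ) + ((N : ℝ) ^ (1 / 4 : ℝ)) ^ 3) * ((S : ℝ) / (N : ℝ))) /
      (L * ((S : ℝ) + ((N : ℝ) ^ (1 / 4 : ℝ)) ^ 2)) := by
  rw [globalStepScale, rpow_three_quarters, sqrt_eq_quarter_sq]

theorem globalStepScale_pos (hS : 1 ≤ S) (hSN : S ≤ N) (hL : 0 < L) :
    0 < globalStepScale N S L := by
  have hw := one_le_quarter (hS.trans hSN)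
  have hS' : (0 : ℝ) < S := by positivity
  have hN' : (0 : ℝ) < N := by exact_mod_cast hS.trans hSN
  rw [globalStepScale_eq]
  positivity

/-- The first bound is (S + w³)/(S + w²) ≤ w; it keeps the accumulated correlation under control,
while the second serves the descent lemma. -/
theorem mul_globalStepScale_le (hS : 1 ≤ S) (hSN : S ≤ N) (hL : 0 < L) :
    L * globalStepScale N S L ≤ (S : ℝ) / N * (N : ℝ) ^ (1 / 4 : ℝ) ∧
      L * globalStepScale N S L ≤ 2 := by
  have hw := one_le_quarter (hS.trans hSN)
  have hS' : (0 : ℝ) < S := by positivity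
  have hN' : (0 : ℝ) < N := by exact_mod_cast hS.trans hSN
  have hSN' : (S : ℝ) ≤ N := by exact_mod_cast hSN
  rw [globalStepScale_eq]
  have hwN := quarter_pow_four N
  set w := (N : ℝ) ^ (1 / 4 : ℝ)
  have hw0 : 0 < w := by linarith
  have e : L * (((S : ℝ) + w ^ 3) * ((S : ℝ) / (N : ℝ)) / (L * ((S : ℝ) + w ^ 2))) =
      ((S : ℝ) + w ^ 3) * ((S : ℝ) / (N : ℝ)) / ((S : ℝ) + w ^ 2) := by
    field_simp
  rw [e]
  constructor
  · rw [div_le_iff₀ (by positivity), mul_assoc, mul_comm]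
    gcongr
    have := mul_le_mul_of_nonneg_right hw hS'.le
    linarith
  · rw [div_le_iff₀ (by positivity), ← mul_div_assoc, div_le_iff₀ hN']
    have h1 : (S : ℝ) * S ≤ S * N := by gcongr
    have h2 : w ^ 3 * S ≤ N * S := by
      rw [← hwN]
      gcongr
      norm_num
    have h3 : 0 ≤ w ^ 2 * N := by positivity
    linarith

/-- In S + w² the larger summand is kept, at the cost of a factor 2: w² if S ≤ √N, and S if S > √N.
The third bound only uses w² ≤ w³. -/
theorem one_le_mul_globalStepScale (hS : 1 ≤ S) (hSN : S ≤ N) (hL : 0 < L) :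
    ((S : ℝ) ≤ √(N : ℝ) → 1 ≤ 2 * ((N : ℝ) ^ (3 / 4 : ℝ) * L / S) * globalStepScale N S L) ∧
    (√(N : ℝ) < S → 1 ≤ 2 * ((N : ℝ) ^ (1 / 4 : ℝ) * L) * globalStepScale N S L) ∧
    1 ≤ 2 * ((N : ℝ) * L / S) * globalStepScale N S L := by
  have hw := one_le_quarter (hS.trans hSN)
  have hS' : (0 : ℝ) < S := by positivity
  have hN' : (0 : ℝ) < N := by exact_mod_cast hS.trans hSN
  rw [globalStepScale_eq, rpow_three_quarters, sqrt_eq_quarter_sq]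
  have hwN := quarter_pow_four N
  set w := (N : ℝ) ^ (1 / 4 : ℝ)
  have hw0 : 0 < w := by linarith
  rw [← hwN]
  refine ⟨fun h => ?_, fun h => ?_, ?_⟩
  · have e : 2 * (w ^ 3 * L / S) * (((S : ℝ) + w ^ 3) * ((S : ℝ) / w ^ 4) /
        (L * ((S : ℝ) + w ^ 2))) = 2 * (S + w ^ 3) / (w * (S + w ^ 2)) := by
      field_simp
    rw [e, le_div_iff₀ (by positivity)]
    have := mul_le_mul_of_nonneg_left h hw0.le
    nlinarith
  · have e : 2 * (w * L) * (((S : ℝ) + w ^ 3) * ((S : ℝ) / w ^ 4) /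
        (L * ((S : ℝ) + w ^ 2))) = 2 * (S + w ^ 3) * S / (w ^ 3 * (S + w ^ 2)) := by
      field_simp
    rw [e, le_div_iff₀ (by positivity)]
    have := mul_le_mul_of_nonneg_left h.le (by positivity : 0 ≤ w ^ 3)
    nlinarith
  · have e : 2 * (w ^ 4 * L / S) * (((S : ℝ) + w ^ 3) * ((S : ℝ) / w ^ 4) /
        (L * ((S : ℝ) + w ^ 2))) = 2 * (S + w ^ 3) / (S + w ^ 2) := by
      field_simp
    rw [e, le_div_iff₀ (by positivity)]
    have h1 : w ^ 2 ≤ w ^ 3 := pow_le_pow_right₀ hw (by norm_num)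
    have h2 : 0 < w ^ 3 := by positivity
    linarith

theorem rpow_half_mul_sqrt (N S : ℕ) :
    ((S : ℝ) / N) ^ (1 / 2 : ℝ) * √(S : ℝ) = S / ((N : ℝ) ^ (1 / 4 : ℝ)) ^ 2 := by
  rw [← Real.sqrt_eq_rpow, ← Real.sqrt_mul (by positivity), div_mul_eq_mul_div,
    Real.sqrt_div (by positivity), Real.sqrt_mul_self (by positivity), sqrt_eq_quarter_sq]

end Scales

/-! ### Choice of parameters and conclusion. -/

/-- The variance of the minibatch gradients of the rounds in which all clients participate. -/
theorem exists_variance_bound {d N M S b₁ : ℕ} {L σ ε p : ℝ} {f : Fin N → Fin M → Vec d → ℝ}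
    (hS : 1 ≤ S) (hSN : S ≤ N) (h₁ : 1 ≤ b₁) (h₁M : b₁ ≤ M) (hL : 0 < L) (hε : 0 < ε)
    (hf : ∀ i j, LSmooth L (f i j)) (hp : p = (S : ℝ) / N)
    (hb : b₁ = M ∨ (BoundedVariance σ f ∧
      min (M : ℝ) (24 * σ ^ 2 / (p ^ (1 / 2 : ℝ) * √(S : ℝ) * (L * ε))) ≤ (b₁ : ℝ))) :
    ∃ v : ℝ, (∀ i x, avg (fun I : Batch M b₁ =>
      ‖batchGrad (f i) I.1 x - gradient (clientLoss (f i)) x‖ ^ 2) ≤ v) ∧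
      v / N * ((N : ℝ) ^ (1 / 4 : ℝ)) ^ 2 ≤ p * (L * ε) := by
  have hw := one_le_quarter (hS.trans hSN)
  have hS' : (0 : ℝ) < S := by positivity
  have hN' : (0 : ℝ) < N := by exact_mod_cast hS.trans hSN
  have hb' : (0 : ℝ) < b₁ := by positivity
  have hfull : b₁ = M → ∃ v : ℝ, (∀ i x, avg (fun I : Batch M b₁ =>
      ‖batchGrad (f i) I.1 x - gradient (clientLoss (f i)) x‖ ^ 2) ≤ v) ∧
      v / N * ((N : ℝ) ^ (1 / 4 : ℝ)) ^ 2 ≤ p * (L * ε) := by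
    rintro rfl
    refine ⟨0, fun i x => ?_, ?_⟩
    · simp only [batchGrad_full fun j => (hf i j).1, sub_self, norm_zero]
      simp [avg]
    · rw [hp, zero_div, zero_mul]
      positivity
  rcases hb with hb | ⟨hvar, hb⟩
  · exact hfull hb
  rcases min_le_iff.1 hb with hb | hb
  · exact hfull (le_antisymm h₁M (by exact_mod_cast hb))
  refine ⟨σ ^ 2 / b₁, fun i x => ?_, ?_⟩
  · refine (avg_norm_batchGrad_sub_sq_le h₁ h₁M (fun j => (hf i j).1) x).trans ?_
    gcongr
    exact hvar i x
  -- Here √p √S = S/√N. The resulting spare factor √N = w² in the bound for v/N later offsets (L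
  -- ηg)² ≤ p² w²/16.
  · rw [hp, rpow_half_mul_sqrt N S, div_le_iff₀ (by positivity)] at hb
    rw [hp]
    set w := (N : ℝ) ^ (1 / 4 : ℝ)
    have hw0 : 0 < w := by linarith
    have e1 : (b₁ : ℝ) * (S / w ^ 2 * (L * ε)) = b₁ * S * (L * ε) / w ^ 2 := by ring
    rw [e1, le_div_iff₀ (by positivity)] at hb
    have e2 : σ ^ 2 / b₁ / N * w ^ 2 = σ ^ 2 * w ^ 2 / (b₁ * N) := by field_simp
    have e3 : (S : ℝ) / N * (L * ε) = b₁ * S * (L * ε) / (b₁ * N) := by field_simp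
    rw [e2, e3]
    have : 0 ≤ σ ^ 2 * w ^ 2 := by positivity
    exact div_le_div_of_nonneg_right (by linarith) (by positivity)

theorem averageGap_le {d N M K S R b₁ b₂ b₃ : ℕ} {L σ ε ηg ηl p : ℝ}
    {f : Fin N → Fin M → Vec d → ℝ} {x₀ xstar : Vec d}
    {Ω : Type*} [MeasurableSpace Ω] {μ : Measure Ω} [IsProbabilityMeasure μ]
    {q : ℕ → Ω → Bool} {Z : ℕ → Ω → RoundDraw N S M K b₁ b₂ b₃}
    (hS : 1 ≤ S) (hSN : S ≤ N) (hK : 1 ≤ K) (hR : 1 ≤ R) (h₁ : 1 ≤ b₁) (h₁M : b₁ ≤ M)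
    (h₂ : 1 ≤ b₂) (h₂M : b₂ ≤ M) (h₃M : b₃ ≤ M) (hL : 0 < L) (hε : 0 < ε)
    (hf : ∀ i j, LSmooth L (f i j)) (hc : ConvexOn ℝ Set.univ (globalLoss f))
    (hmin : ∀ x, globalLoss f xstar ≤ globalLoss f x) (hp : p = (S : ℝ) / N)
    (hsamp : IsSampling μ (fun r => if r = 0 then 1 else p) q Z)
    (hb : b₁ = M ∨ (BoundedVariance σ f ∧
      min (M : ℝ) (24 * σ ^ 2 / (p ^ (1 / 2 : ℝ) * √(S : ℝ) * (L * ε))) ≤ (b₁ : ℝ)))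
    (hηg : 0 < ηg) (hηg' : ηg ≤ 1 / 4 * globalStepScale N S L)
    (hηl : 0 < ηl) (hηl' : ηl ≤ 1 / 32 * localStepScale N S K R L) :
    averageGap μ f ηg ηl x₀ xstar q Z R ≤ 16 * (‖x₀ - xstar‖ ^ 2 / (ηg * R)) + 32 * ε := by
  have hw := one_le_quarter (hS.trans hSN)
  have hS' : (0 : ℝ) < S := by positivity
  have hN' : (0 : ℝ) < N := by exact_mod_cast hS.trans hSN
  have hR' : (0 : ℝ) < R := by positivity
  have hK' : (0 : ℝ) < K := by positivity
  have hSN' : (S : ℝ) ≤ N := by exact_mod_cast hSN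
  have hp0 : 0 < p := by rw [hp]; positivity
  have hp1 : p ≤ 1 := by rw [hp]; exact (div_le_one hN').2 hSN'
  obtain ⟨v, hv, hvε⟩ := exists_variance_bound hS hSN h₁ h₁M hL hε hf hp hb
  obtain ⟨hg1, hg2⟩ := mul_globalStepScale_le hS hSN hL
  have hg := mul_le_mul_of_nonneg_left hηg' hL.le
  rw [← hp] at hg1
  rw [localStepScale, rpow_five_quarters] at hηl'
  have hwN := quarter_pow_four N
  set w := (N : ℝ) ^ (1 / 4 : ℝ)
  have hw0 : 0 < w := by linarith
  have hw1 : 1 ≤ w ^ 2 := one_le_pow₀ hw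
  have hh : L * ηg ≤ 1 / 2 := by linarith
  have hhw : L * ηg ≤ 1 / 4 * (p * w) := by linarith
  have hτ0 : 0 < 4 * (L * ηl) * K := by positivity
  have hτ : 4 * (L * ηl) * K ≤ 1 / 8 * (p / (w * √(R : ℝ))) := by
    have h1 := mul_le_mul_of_nonneg_left hηl' (by positivity : 0 ≤ 4 * L * K)
    have hsR : 0 < √(R : ℝ) := Real.sqrt_pos.2 hR'
    have e : 4 * L * K * (1 / 32 * ((S : ℝ) / (w ^ 5 * K * L * √(R : ℝ)))) =
        1 / 8 * (p / (w * √(R : ℝ))) := by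
      rw [hp, ← hwN]
      field_simp
      norm_num
    linarith
  have hτ2 : (4 * (L * ηl) * K) ^ 2 * R * w ^ 2 ≤ 1 / 64 * p ^ 2 := by
    have h1 := pow_le_pow_left₀ hτ0.le hτ 2
    have hsR : √(R : ℝ) ^ 2 = R := Real.sq_sqrt hR'.le
    have e : (1 / 8 * (p / (w * √(R : ℝ)))) ^ 2 = 1 / 64 * p ^ 2 / (R * w ^ 2) := by
      rw [mul_pow, div_pow p, mul_pow, hsR]
      ring
    rw [e, le_div_iff₀ (by positivity)] at h1
    linarith
  have hR1 : (1 : ℝ) ≤ R := by exact_mod_cast hR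
  set τ := 4 * (L * ηl) * K with hτdef
  have hτR : τ ^ 2 * R ≤ 1 / 64 * p ^ 2 :=
    (le_mul_of_one_le_right (by positivity) hw1).trans hτ2
  have hτw : τ ^ 2 * w ^ 2 ≤ 1 / 64 * p ^ 2 := by
    refine le_trans ?_ hτ2
    gcongr
    exact le_mul_of_one_le_right (by positivity) hR1
  have hu : 2 * (L * ηl) * K ≤ 1 := by
    have h1 : τ ^ 2 ≤ 1 := by
      have i1 : τ ^ 2 ≤ τ ^ 2 * R := le_mul_of_one_le_right (by positivity) hR1
      have i2 : p ^ 2 ≤ 1 := pow_le_one₀ hp0.le hp1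
      linarith
    have h2 : τ ≤ 1 := by nlinarith
    linarith
  have hh2 : (L * ηg) ^ 2 ≤ 1 / 16 * (p ^ 2 * w ^ 2) := by
    have := pow_le_pow_left₀ (by positivity) hhw 2
    linarith
  have hSp : (S : ℝ) = p * w ^ 4 := by rw [hwN, hp]; field_simp
  set B := (L * ηg) ^ 2 / S + 2 * τ ^ 2 / p with hB
  have hB0 : 0 ≤ B := by positivity
  -- The gain 1/w² over a constant bound comes from S = p w⁴, and it cancels the w² of (L ηg)² in
  -- `hhA`.
  have hAw : 2 * B / p * w ^ 2 ≤ 1 / 4 := by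
    have e : 2 * B / p * w ^ 2 =
        2 * ((L * ηg) ^ 2 / (p ^ 2 * w ^ 2)) + 4 * (τ ^ 2 * w ^ 2 / p ^ 2) := by
      rw [hB, hSp]
      field_simp
      ring
    have i1 : (L * ηg) ^ 2 / (p ^ 2 * w ^ 2) ≤ 1 / 16 := by
      rw [div_le_iff₀ (by positivity)]
      exact hh2
    have i2 : τ ^ 2 * w ^ 2 / p ^ 2 ≤ 1 / 64 := by
      rw [div_le_iff₀ (by positivity)]
      exact hτw
    rw [e]
    linarith
  have hA : 2 * B / p ≤ 1 / 4 :=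
    (le_mul_of_one_le_right (by positivity) hw1).trans hAw
  have hhA : (L * ηg) ^ 2 * (2 * B / p) ≤ p ^ 2 := by
    have i1 := mul_le_mul_of_nonneg_right hh2 (by positivity : 0 ≤ 2 * B / p)
    have i2 := mul_le_mul_of_nonneg_left hAw (sq_nonneg p)
    nlinarith [sq_nonneg p]
  have hv0 : 0 ≤ v :=
    (avg_nonneg fun _ => by positivity).trans (hv ⟨0, hS.trans hSN⟩ x₀)
  have hLε : 0 < L * ε := by positivity
  have hν : v / N ≤ L * ε := by
    have i1 : v / N ≤ v / N * w ^ 2 := le_mul_of_one_le_right (by positivity) hw1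
    have i2 : p * (L * ε) ≤ L * ε := mul_le_of_le_one_left hLε.le hp1
    linarith
  have hhν : (L * ηg) ^ 2 * (v / N) ≤ p ^ 2 * (L * ε) := by
    have i1 := mul_le_mul_of_nonneg_right hh2 (by positivity : 0 ≤ v / N)
    have i2 := mul_le_mul_of_nonneg_left hvε (sq_nonneg p)
    have i3 : p * (L * ε) ≤ L * ε := mul_le_of_le_one_left hLε.le hp1
    have i4 := mul_le_mul_of_nonneg_left i3 (sq_nonneg p)
    have i5 : 0 ≤ p ^ 2 * (L * ε) := by positivity
    linarith
  have H := hsamp.gapRecursion (x₀ := x₀) hK hS hSN h₁ h₁M h₂ h₂M h₃M hL.le hηg.le hηl hf hc hmin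
    hu hh hp0 hp1 hv
  have key := H.sum_F_succ_le hp0 hp1 hηg hL hB0 hτ0 (by positivity) hε.le hR hh hA hhA
    (hτR.trans (by linarith [sq_nonneg p])) hν hhν
  have h1 : averageGap μ f ηg ηl x₀ xstar q Z R ≤
      1 / (R : ℝ) * (16 * (‖x₀ - xstar‖ ^ 2 / ηg) + 32 * R * ε) :=
    mul_le_mul_of_nonneg_left key (by positivity)
  refine h1.trans_eq ?_
  field_simp

end FedPAGE

theorem theorem4 :
    ∃ cg : ℝ, 0 < cg ∧ ∃ cl : ℝ, 0 < cl ∧ ∀ a : ℝ, 0 < a → a ≤ cg → ∃ C : ℝ, 0 < C ∧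
      ∀ (d N M K S R b₁ b₂ b₃ : ℕ) (L σ ε ηg ηl p : ℝ)
        (f : Fin N → Fin M → FedPAGE.Vec d → ℝ) (x₀ xstar : FedPAGE.Vec d)
        (Ω : Type*) [MeasurableSpace Ω] (μ : MeasureTheory.Measure Ω)
        [MeasureTheory.IsProbabilityMeasure μ]
        (q : ℕ → Ω → Bool) (Z : ℕ → Ω → FedPAGE.RoundDraw N S M K b₁ b₂ b₃),
        1 ≤ S → S ≤ N → 1 ≤ K → 1 ≤ R →
        1 ≤ b₁ → b₁ ≤ M → 1 ≤ b₂ → b₂ ≤ M → 1 ≤ b₃ → b₃ ≤ M →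
        0 < L → 0 ≤ σ → 0 < ε →
        -- assumptions on the objective
        (∀ i j, FedPAGE.LSmooth L (f i j)) →
        ConvexOn ℝ Set.univ (FedPAGE.globalLoss f) →
        (∀ x, FedPAGE.globalLoss f xstar ≤ FedPAGE.globalLoss f x) →
        -- sampling probabilities
        p = (S : ℝ) / (N : ℝ) →
        FedPAGE.IsSampling μ (fun r => if r = 0 then 1 else p) q Z →
        -- minibatch sizes: full local gradients, or bounded variance and moderate minibatches
        ((b₁ = M ∧ b₂ = M) ∨
          (FedPAGE.BoundedVariance σ f ∧
            min (M : ℝ) (24 * σ ^ 2 / (p ^ (1 / 2 : ℝ) * √(S : ℝ) * (L * ε))) ≤ (b₁ : ℝ) ∧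
            min (M : ℝ) (48 * σ ^ 2 / (p ^ (3 / 2 : ℝ) * √(S : ℝ) * ε)) ≤ (b₂ : ℝ))) →
        -- step sizes
        a * FedPAGE.globalStepScale N S L ≤ ηg → ηg ≤ cg * FedPAGE.globalStepScale N S L →
        0 < ηl → ηl ≤ cl * FedPAGE.localStepScale N S K R L →
        ((S : ℝ) ≤ √(N : ℝ) →
          FedPAGE.averageGap μ f ηg ηl x₀ xstar q Z R ≤
            C * ((N : ℝ) ^ (3 / 4 : ℝ) * L * ‖x₀ - xstar‖ ^ 2 / ((S : ℝ) * (R : ℝ)) + ε)) ∧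
        (√(N : ℝ) < (S : ℝ) → (S : ℝ) ≤ (N : ℝ) ^ (3 / 4 : ℝ) →
          FedPAGE.averageGap μ f ηg ηl x₀ xstar q Z R ≤
            C * ((N : ℝ) ^ (1 / 4 : ℝ) * L * ‖x₀ - xstar‖ ^ 2 / (R : ℝ) + ε)) ∧
        ((N : ℝ) ^ (3 / 4 : ℝ) < (S : ℝ) →
          FedPAGE.averageGap μ f ηg ηl x₀ xstar q Z R ≤
            C * ((N : ℝ) * L * ‖x₀ - xstar‖ ^ 2 / ((S : ℝ) * (R : ℝ)) + ε)) := by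
  -- With 1/4, L times the step scale being at most 2 gives L ηg ≤ 1/2; with 1/32, τ ≤ p/(8 w √R).
  -- In C, the term 32/a is 16 times the factor 2/a from 1/ηg ≤ 2T/a, and 32 multiplies ε.
  refine ⟨1 / 4, by norm_num, 1 / 32, by norm_num, fun a ha _ => ⟨32 / a + 32, by positivity, ?_⟩⟩
  intro d N M K S R b₁ b₂ b₃ L σ ε ηg ηl p f x₀ xstar Ω _ μ _ q Z hS hSN hK hR h₁ h₁M h₂ h₂M _ h₃M
    hL _ hε hf hc hmin hp hsamp hb hlow hup hηl hηl'
  have hscale := FedPAGE.globalStepScale_pos hS hSN hL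
  have hηg : 0 < ηg := lt_of_lt_of_le (by positivity) hlow
  have hR' : (0 : ℝ) < R := by positivity
  have hgap := FedPAGE.averageGap_le (x₀ := x₀) hS hSN hK hR h₁ h₁M h₂ h₂M h₃M hL hε hf hc hmin hp
    hsamp (hb.imp And.left fun h => ⟨h.1, h.2.1⟩) hηg hup hηl hηl'
  have hfinal : ∀ T : ℝ, 0 ≤ T → 1 ≤ 2 * T * FedPAGE.globalStepScale N S L →
      FedPAGE.averageGap μ f ηg ηl x₀ xstar q Z R ≤
        (32 / a + 32) * (T * ‖x₀ - xstar‖ ^ 2 / R + ε) := by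
    intro T hT hTs
    have h1 : 1 / ηg ≤ 2 * T / a := by
      rw [div_le_div_iff₀ hηg ha]
      have i1 := mul_le_mul_of_nonneg_left hlow (by positivity : 0 ≤ 2 * T)
      have i2 := mul_le_mul_of_nonneg_left hTs ha.le
      linarith
    have h2 : ‖x₀ - xstar‖ ^ 2 / (ηg * R) ≤ 2 / a * (T * ‖x₀ - xstar‖ ^ 2 / R) := by
      calc ‖x₀ - xstar‖ ^ 2 / (ηg * R) = 1 / ηg * (‖x₀ - xstar‖ ^ 2 / R) := by field_simp
        _ ≤ 2 * T / a * (‖x₀ - xstar‖ ^ 2 / R) := by gcongr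
        _ = _ := by ring
    have h3 : 0 ≤ T * ‖x₀ - xstar‖ ^ 2 / R := by positivity
    have h4 : 0 ≤ 32 / a * ε := by positivity
    have h5 : (32 / a + 32) * (T * ‖x₀ - xstar‖ ^ 2 / R + ε) =
        16 * (2 / a * (T * ‖x₀ - xstar‖ ^ 2 / R)) + 32 * (T * ‖x₀ - xstar‖ ^ 2 / R) +
          32 / a * ε + 32 * ε := by ring
    rw [h5]
    linarith
  obtain ⟨hs1, hs2, hs3⟩ := FedPAGE.one_le_mul_globalStepScale hS hSN hL
  refine ⟨fun h => ?_, fun h _ => ?_, fun _ => ?_⟩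
  · refine (hfinal _ (by positivity) (hs1 h)).trans_eq ?_
    congr 2
    field_simp
  · exact hfinal _ (by positivity) (hs2 h)
  · refine (hfinal _ (by positivity) hs3).trans_eq ?_
    congr 2
    field_simp
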